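/- Let $p>q$ be primes, $g\ge 1$ an integer, $n=gq+1$, and let $e$ be the order of $p$ modulo $q$. Assume $p^e>n$ and $p\ge n+q-2$. For $s\ge 1$ put $$\Phi_s(t,z)=\big((t-z_1)\cdots(t-z_n)\big)^{(p^{es}-1)/q}\in\mathbb Z[z_1,\dots,z_n][t].$$ Let $A(\Phi_s)(z)$ be the $g\times g$ matrix whose $(u,v)$ entry, $1\le u,v\le g$, is the coefficient of $t^{vp^{es}-u}$ in $\Phi_s(t,z)$, and let $I_s(z)$ be the $n\times g$ matrix whose $(i,\ell)$ entry is the coefficient of $t^{\ell p^{es}-1}$ in $\Phi_s(t,z)/(t-z_i)$. For an $n\times g$ matrix $B$ denote by $\mu(B)$ its $g\times g$ minor in the rows with indices $q(g-\ell)+1$, $\ell=1,\dots,g$. Let $M(z)=\mu(I_1(z))$, and let $d_\Phi$ and $d_M$ be the degrees of the polynomials $\det A(\Phi_1)(z)$ and $M(z)$. For $m\ge 1$ let $\mathbb Q_p^{(m)}$ be the unramified extension of $\mathbb Q_p$ of degree $m$, with the norm $|\cdot|_p$ normalized by $|p|_p=1/p$ and the ring of integers $\mathbb Z_p^{(m)}$.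 Let $$\mathfrak D^{(m)}_{\mathrm{KZ}}=\{a\in(\mathbb Z_p^{(m)})^n:\ |\det A(\Phi_1)(a)|_p=1\},\qquad \mathfrak D^{(m),o}_{\mathrm{KZ}}=\{a\in\mathfrak D^{(m)}_{\mathrm{KZ}}:\ a_i\ne a_j \text{ for } i\neq j\},$$ and let $W\subset(\mathbb Q_p^{(m)})^n$ be the subspace of vectors with zero sum of coordinates. **Theorem.** Assume $p^m>d_\Phi+d_M$. Then: 1. The sequence of matrices $I_s(a)\,A(\Phi_s)(a)^{-1}$ converges as $s\to\infty$, uniformly on $\mathfrak D^{(m)}_{\mathrm{KZ}}$, to an $n\times g$ matrix $\mathcal I(a)$. The entries of $\mathcal I$ are analytic on $\mathfrak D^{(m)}_{\mathrm{KZ}}$: on each open unit polydisc contained in $\mathfrak D^{(m)}_{\mathrm{KZ}}$ they are given by a power series convergent on that polydisc. 2. The subspaces $\mathcal L_a\subset(\mathbb Q_p^{(m)})^n$ spanned by the columns of $\mathcal I(a)$, $a\in\mathfrak D^{(m),o}_{\mathrm{KZ}}$, are contained in $W$ and form an analytic vector bundle of rank $g$ over $\mathfrak D^{(m),o}_{\mathrm{KZ}}$: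 $\dim\mathcal L_a=g$ for every $a\in\mathfrak D^{(m),o}_{\mathrm{KZ}}$, and near each point of $\mathfrak D^{(m),o}_{\mathrm{KZ}}$ the family $\mathcal L$ has a frame of $g$ analytic sections. 3. For every $a\in\mathfrak D^{(m)}_{\mathrm{KZ}}$ one has $\mu(\mathcal I(a))\equiv\mu\big(I_1(a)A(\Phi_1)(a)^{-1}\big)\pmod p$, and the function $a\mapsto\mu(\mathcal I(a))$ is not identically zero modulo $p$ on $\mathfrak D^{(m),o}_{\mathrm{KZ}}$: $|\mu(\mathcal I(a))|_p=1$ for some $a\in\mathfrak D^{(m),o}_{\mathrm{KZ}}$. In particular $\mathfrak D^{(m),o}_{\mathrm{KZ}}$ is nonempty. -/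

import Mathlib

open Filter Topology

noncomputable section

namespace PadicKZ

/-! ### Unramified extensions of the field of `p`-adic numbers -/

/-- The unramified extension of `ℚ_[p]` of degree `m` inside a fixed algebraic closure, obtained
by attaching the primitive roots of unity of order `p ^ m - 1` (for `m ≥ 1`). -/
def unramifiedField (p m : ℕ) [Fact p.Prime] : IntermediateField ℚ_[p] (PadicAlgCl p) :=
  IntermediateField.adjoin ℚ_[p] {ζ : PadicAlgCl p | IsPrimitiveRoot ζ (p ^ m - 1)}

/-- The unramified extension as a type; it carries the norm of the algebraic closure, which
extends the norm of `ℚ_[p]` (so `‖p‖ = 1 / p`). -/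
abbrev Unr (p m : ℕ) [Fact p.Prime] : Type := ↥(unramifiedField p m)

instance unrNontriviallyNormedField (p m : ℕ) [Fact p.Prime] :
    NontriviallyNormedField (Unr p m) where
  __ := (inferInstance : NormedField (Unr p m))
  non_trivial := by
    obtain ⟨x, hx⟩ := NormedField.exists_one_lt_norm ℚ_[p]
    refine ⟨algebraMap ℚ_[p] (Unr p m) x, ?_⟩
    have h : ‖algebraMap ℚ_[p] (Unr p m) x‖ = ‖x‖ := PadicAlgCl.norm_extends p x
    rw [h]
    exact hx

/-! ### Master polynomials, solutions modulo powers of `p`, Hasse-Witt matrices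

The variables `z_1, …, z_n`, with `n = g * q + 1`, are indexed by `Fin (g * q + 1)`, starting from
zero; the columns `ℓ = 1, …, g` are indexed by `Fin g`, so that `ℓ` is `(l : ℕ) + 1`. -/

/-- The order `e` of `p` modulo `q`. -/
def ord (p q : ℕ) : ℕ := orderOf (p : ZMod q)

/-- The master polynomial `Φ_s(t, z) = ((t - z_1) ⋯ (t - z_n)) ^ ((p ^ (e * s) - 1) / q)`, as a
polynomial in `t` with coefficients in `ℤ[z]`; the division in the exponent is exact. -/
def master (p q g s : ℕ) : Polynomial (MvPolynomial (Fin (g * q + 1)) ℤ) :=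
  (∏ i : Fin (g * q + 1), (Polynomial.X - Polynomial.C (MvPolynomial.X i))) ^
    ((p ^ (ord p q * s) - 1) / q)

/-- The `n × g` matrix `I_s(z)`: the entry in row `i` and column `ℓ` is the coefficient of
`t ^ (ℓ * p ^ (e * s) - 1)` in `Φ_s(t, z) / (t - z_i)` (an exact division for `s ≥ 1`). -/
def solMatrix (p q g s : ℕ) :
    Matrix (Fin (g * q + 1)) (Fin g) (MvPolynomial (Fin (g * q + 1)) ℤ) :=
  Matrix.of fun i l =>
    (master p q g s /ₘ (Polynomial.X - Polynomial.C (MvPolynomial.X i))).coeff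
      (((l : ℕ) + 1) * p ^ (ord p q * s) - 1)

/-- The Hasse-Witt matrix `A(Φ_s)`: the entry `(u, v)`, where `1 ≤ u, v ≤ g`, is the coefficient
of `t ^ (p ^ (e * s) * v - u)` in `Φ_s(t, z)`. -/
def hasseWitt (p q g s : ℕ) :
    Matrix (Fin g) (Fin g) (MvPolynomial (Fin (g * q + 1)) ℤ) :=
  Matrix.of fun u v =>
    (master p q g s).coeff (p ^ (ord p q * s) * ((v : ℕ) + 1) - ((u : ℕ) + 1))

/-- The row with (one-based) index `q * (g - ℓ) + 1`, for `ℓ = 1, …, g`. -/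
def minorRow (q g : ℕ) (l : Fin g) : Fin (g * q + 1) :=
  ⟨q * (g - ((l : ℕ) + 1)), Nat.lt_succ_of_le
    (by rw [Nat.mul_comm g q]; exact Nat.mul_le_mul_left q (Nat.sub_le _ _))⟩

/-- The `g × g` minor of an `n × g` matrix in the rows `q * (g - ℓ) + 1`, `ℓ = 1, …, g`. -/
def rowMinor {R : Type*} [CommRing R] (q g : ℕ) (B : Matrix (Fin (g * q + 1)) (Fin g) R) : R :=
  (B.submatrix (minorRow q g) id).det

/-- The degree `d_Φ` of the polynomial `det A(Φ_1)`. -/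
def degPhi (p q g : ℕ) : ℕ := (hasseWitt p q g 1).det.totalDegree

/-- The degree `d_M` of the polynomial `M(z)`, the above minor of `I_1(z)`. -/
def degM (p q g : ℕ) : ℕ := (rowMinor q g (solMatrix p q g 1)).totalDegree

/-! ### The domains, the limit matrix and the distribution -/

section

variable (p q g m : ℕ) [Fact p.Prime]

/-- The space in which `z = (z_1, …, z_n)` varies, with the maximum norm. -/
abbrev Space : Type := Fin (g * q + 1) → Unr p m

/-- The value at a point `a` of the matrix `A(Φ_s)`. -/
def hasseWittAt (s : ℕ) (a : Space p q g m) : Matrix (Fin g) (Fin g) (Unr p m) :=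
  (hasseWitt p q g s).map (MvPolynomial.aeval a)

/-- The value at a point `a` of the matrix `I_s`. -/
def solMatrixAt (s : ℕ) (a : Space p q g m) : Matrix (Fin (g * q + 1)) (Fin g) (Unr p m) :=
  (solMatrix p q g s).map (MvPolynomial.aeval a)

/-- The domain of points with integral coordinates at which `det A(Φ_1)` has norm one. -/
def domain : Set (Space p q g m) :=
  {a | (∀ i, ‖a i‖ ≤ 1) ∧ ‖(hasseWittAt p q g m 1 a).det‖ = 1}

/-- The part of the domain outside the diagonal hyperplanes. -/
def domainO : Set (Space p q g m) :=
  {a | a ∈ domain p q g m ∧ ∀ i j, i ≠ j → a i ≠ a j}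

/-- The matrix `I_s(a) * A(Φ_s)(a)⁻¹`. -/
def approxMatrix (s : ℕ) (a : Space p q g m) : Matrix (Fin (g * q + 1)) (Fin g) (Unr p m) :=
  solMatrixAt p q g m s a * (hasseWittAt p q g m s a)⁻¹

/-- The `p`-adic limit `𝓘(a)` of the matrices `I_s(a) * A(Φ_s)(a)⁻¹` as `s → ∞`. -/
def limitMatrix (a : Space p q g m) : Matrix (Fin (g * q + 1)) (Fin g) (Unr p m) :=
  Matrix.of fun i l => limUnder atTop fun s : ℕ => approxMatrix p q g m s a i l

/-- The fiber `W` of the trivial bundle: the vectors with zero sum of coordinates. -/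
def zeroSum : Submodule (Unr p m) (Space p q g m) where
  carrier := {x | ∑ i, x i = 0}
  zero_mem' := by simp
  add_mem' := by
    intro x y hx hy
    simp only [Set.mem_ofPred_eq] at hx hy ⊢
    simp [Finset.sum_add_distrib, hx, hy]
  smul_mem' := by
    intro c x hx
    simp only [Set.mem_ofPred_eq] at hx ⊢
    simp [← Finset.mul_sum, hx]

/-- The subspace `𝓛_a` spanned by the columns of the matrix `𝓘(a)`. -/
def distribution (a : Space p q g m) : Submodule (Unr p m) (Space p q g m) :=
  Submodule.span (Unr p m) (Set.range fun l : Fin g => (limitMatrix p q g m a).col l)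

end

/-! ### Analytic functions and analytic vector bundles -/

/-- A function is analytic on a union `D` of open polydiscs of radius one if on each of these
polydiscs it is the sum of a power series that converges on the whole polydisc. -/
def AnalyticOnPolydiscs {K E F : Type*} [NontriviallyNormedField K] [NormedAddCommGroup E]
    [NormedSpace K E] [NormedAddCommGroup F] [NormedSpace K F] (f : E → F) (D : Set E) : Prop :=
  ∀ a ∈ D, ∃ P : FormalMultilinearSeries K E F, HasFPowerSeriesOnBall f P a 1

/-- A family `L` of subspaces of `W`, indexed by the points of `D`, is an analytic vector bundle
of rank `r` over `D` (a subbundle of the trivial bundle `W × D`): all its members have dimension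
`r`, and near every point of `D` it has a frame that consists of `r` analytic sections. -/
structure IsAnalyticBundle {K E V : Type*} [NontriviallyNormedField K] [NormedAddCommGroup E]
    [NormedSpace K E] [NormedAddCommGroup V] [NormedSpace K V] (W : Submodule K V) (D : Set E)
    (L : E → Submodule K V) (r : ℕ) : Prop where
  le : ∀ a ∈ D, L a ≤ W
  rank : ∀ a ∈ D, Module.finrank K (L a) = r
  frame : ∀ a ∈ D, ∃ U : Set E, IsOpen U ∧ a ∈ U ∧ ∃ f : Fin r → E → V,
    (∀ j, AnalyticOnNhd K (f j) U) ∧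
    ∀ b ∈ U ∩ D, LinearIndependent K (fun j => f j b) ∧
      Submodule.span K (Set.range fun j => f j b) = L b

end PadicKZ

end

open Filter Topology

noncomputable section

namespace PadicKZ

section

open Polynomial

/-! ### Coefficients of powers and divisibility by powers of a prime -/

/-! Write Q = p^e, N_s = (Q^s - 1)/q and F = ∏ (t - z_i), so that Φ_s = F^{N_s}. The core is the
Dwork congruence I_{s+1} A_{s+1}⁻¹ ≡ I_s A_s⁻¹ mod p^s (`pow_dvd_approxEval_succ_sub`). It follows
from Φ_{s+1} = Φ_s · Φ_1^{Q^s}, because the coefficient of t^k in a Q^s-th power is highly divisible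
by p unless k is (`CoeffDvd.mul_pow`). It holds in every commutative ring in which p is regular and
all det A_s are units. The units come from characteristic p, where A_{s+1} is A_1 times a Frobenius
twist of A_s (`hasseWittEval_succ`).

Over the ring of integers O the congruence gives uniform convergence. Over O[[x]], at the point a +
x, it gives a limit power series with coefficients in O; this converges on the open unit polydisc
and evaluates to the limit matrix, hence analyticity (`exists_hasFPowerSeriesOnBall_limit`).

The derivative of t^k F^{N_s} has coefficients divisible by Q^s at exponents ≡ -1 mod Q^s. For k = 0
this gives zero column sums in the limit. For 1 ≤ k ≤ g it says that the matrix of powers z_i^k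
times the limit matrix is an explicit triangular matrix with nonzero diagonal, so the columns are
independent (`powerMatrix_mul_limit`).

For the minor, let the coordinates coalesce, modulo p, into g clusters of size q, one of them at 0,
and a single point. There the same relation makes det A_1 times a unit a multiple of the minor M,
and det A_1 ≠ 0 can be arranged by moving clusters towards infinity
(`exists_det_ne_zero_and_rowMinor_ne_zero`). Hence det A_1 · M is nonzero modulo p; its degree is
below p^m, so it is nonzero at some point over the residue field, and that point is lifted. -/

theorem pow_dvd_of_pow_dvd_natCast_mul {R : Type*} [CommRing R] {p : ℕ} (hp : p.Prime)
    (hreg : (p : R) ∈ nonZeroDivisors R) {a b k : ℕ} {c : R} (hk : ¬ p ^ (b + 1) ∣ k)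
    (h : (p : R) ^ a ∣ (k : R) * c) : (p : R) ^ (a - b) ∣ c := by
  have hk0 : k ≠ 0 := by rintro rfl; exact hk (dvd_zero _)
  obtain ⟨v, k', hk', rfl⟩ := Nat.exists_eq_pow_mul_and_not_dvd hk0 p hp.ne_one
  have hv : v ≤ b := by
    by_contra! hv
    exact hk (Dvd.dvd.mul_right (pow_dvd_pow p hv) k')
  refine dvd_trans (pow_dvd_pow _ (Nat.sub_le_sub_left hv a)) ?_
  rcases le_total a v with hav | hav
  · simp [Nat.sub_eq_zero_of_le hav]
  have h2 : (p : R) ^ (a - v) ∣ (k' : R) * c := by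
    obtain ⟨d, hd⟩ := h
    refine ⟨d, ?_⟩
    have hreg' := pow_mem hreg v
    rw [← mul_cancel_left_mem_nonZeroDivisors hreg', ← mul_assoc, ← mul_assoc, ← pow_add,
      Nat.add_sub_cancel' hav, ← hd]
    push_cast
    ring
  -- After cancelling the p-part of k, only a factor prime to p is left, and it is invisible to
  -- powers of p.
  have hco : IsCoprime ((p : R) ^ (a - v)) (k' : R) := by
    apply IsCoprime.pow_left
    have := (Nat.isCoprime_iff_coprime.2 ((Nat.Prime.coprime_iff_not_dvd hp).2 hk')).map
      (Int.castRingHom R)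
    simpa using this
  exact hco.dvd_of_dvd_mul_left h2

/-- The derivative of f^M is a multiple of M. -/
theorem natCast_dvd_natCast_mul_coeff_pow {R : Type*} [CommRing R] (f : R[X]) (M k : ℕ) :
    (M : R) ∣ (k : R) * (f ^ M).coeff k := by
  rcases k with _ | k
  · simp
  have h := coeff_derivative (f ^ M) k
  rw [derivative_pow, mul_assoc, coeff_C_mul] at h
  exact ⟨_, by push_cast; rw [mul_comm, ← h]⟩

/-- The coefficients of `H` at the multiples of `Q ^ i` are divisible by `p ^ i`, for `i ≤ s`. -/
def CoeffDvd {R : Type*} [CommRing R] (p Q s : ℕ) (H : R[X]) : Prop :=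
  ∀ i ≤ s, ∀ k, Q ^ i ∣ k → (p : R) ^ i ∣ H.coeff k

/-- Each term of the convolution is balanced by the level w of Q-divisibility of k: the coefficient
of H at N - k contributes p^{min(i,w)} and that of the power contributes p^{s-w}. -/
theorem CoeffDvd.mul_pow {R : Type*} [CommRing R] {p e s : ℕ} (hp : p.Prime) (he : 0 < e)
    (hreg : (p : R) ∈ nonZeroDivisors R) {H : R[X]} (hH : CoeffDvd p (p ^ e) s H) (f : R[X]) :
    CoeffDvd p (p ^ e) s (H * f ^ (p ^ e) ^ s) := by
  intro i hi N hN
  rw [coeff_mul]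
  refine Finset.dvd_sum fun ⟨a, k⟩ hak => ?_
  replace hak := Finset.HasAntidiagonal.mem_antidiagonal.1 hak
  dsimp only at hak ⊢
  have hw0 : (p ^ e) ^ 0 ∣ k := by simp
  set w := Nat.findGreatest (fun w => (p ^ e) ^ w ∣ k) s with hw
  have hwk : (p ^ e) ^ w ∣ k :=
    Nat.findGreatest_spec (P := fun w => (p ^ e) ^ w ∣ k) (Nat.zero_le s) hw0
  have hws : w ≤ s := Nat.findGreatest_le s
  have h1 : (p : R) ^ min i w ∣ H.coeff a := by
    refine hH _ ((min_le_left _ _).trans hi) _ ?_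
    have ha : a = N - k := by omega
    rw [ha]
    exact Nat.dvd_sub ((pow_dvd_pow _ (min_le_left _ _)).trans hN)
      ((pow_dvd_pow _ (min_le_right _ _)).trans hwk)
  have h2 : (p : R) ^ (s - w) ∣ (f ^ (p ^ e) ^ s).coeff k := by
    rcases hws.eq_or_lt with h | h
    · simp [h]
    -- By maximality of w < s the valuation of k is at most e(w+1) - 1, which leaves es - e(w+1) + 1
    -- ≥ s - w factors p.
    have hk : ¬ p ^ ((e * (w + 1) - 1) + 1) ∣ k := by
      have h3 := Nat.findGreatest_is_greatest (P := fun w => (p ^ e) ^ w ∣ k)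
        (n := s) (k := w + 1) (Nat.lt_succ_self _) h
      rwa [Nat.sub_add_cancel (Nat.mul_pos he (Nat.succ_pos w)), pow_mul]
    have h4 := natCast_dvd_natCast_mul_coeff_pow f ((p ^ e) ^ s) k
    rw [Nat.cast_pow, Nat.cast_pow] at h4
    refine dvd_trans (pow_dvd_pow _ ?_) (pow_dvd_of_pow_dvd_natCast_mul hp hreg hk
      (a := e * s) (by rw [pow_mul]; exact h4))
    obtain ⟨d, hd⟩ := Nat.exists_eq_add_of_lt h
    rw [hd]
    have h5 : e * (w + d + 1) = e * (w + 1) + e * d := by ring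
    clear_value w
    have h6 : d ≤ e * d := Nat.le_mul_of_pos_left d he
    have h7 : 0 < e * (w + 1) := Nat.mul_pos he (Nat.succ_pos w)
    omega
  refine dvd_trans ?_ (mul_dvd_mul h1 h2)
  rw [← pow_add]
  exact pow_dvd_pow _ (by omega)

/-! ### Evaluation of the master polynomials -/

/-- The evaluation at `z` of polynomials with integer coefficients. -/
def evalInt {R ι : Type*} [CommRing R] (z : ι → R) : MvPolynomial ι ℤ →+* R :=
  MvPolynomial.eval₂Hom (Int.castRingHom R) z

theorem evalInt_X {R ι : Type*} [CommRing R] (z : ι → R) (i : ι) :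
    evalInt z (MvPolynomial.X i) = z i := by simp [evalInt]

theorem comp_evalInt {R S ι : Type*} [CommRing R] [CommRing S] (φ : R →+* S) (z : ι → R) :
    φ.comp (evalInt z) = evalInt (fun i => φ (z i)) := by
  apply MvPolynomial.ringHom_ext
  · intro r; simp [evalInt]
  · intro i; simp [evalInt]

theorem map_evalInt {R S ι : Type*} [CommRing R] [CommRing S] (φ : R →+* S) (z : ι → R)
    (P : MvPolynomial ι ℤ) : φ (evalInt z P) = evalInt (fun i => φ (z i)) P := by
  rw [← comp_evalInt]; rfl

theorem aeval_eq_evalInt {R ι : Type*} [CommRing R] [Algebra ℤ R] (z : ι → R)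
    (P : MvPolynomial ι ℤ) : MvPolynomial.aeval z P = evalInt z P := by
  have : (MvPolynomial.aeval z : MvPolynomial ι ℤ →ₐ[ℤ] R).toRingHom = evalInt z := by
    apply MvPolynomial.ringHom_ext
    · intro r; simp [evalInt]
    · intro i; simp [evalInt]
  exact congrArg (fun φ : MvPolynomial ι ℤ →+* R => φ P) this

/-- The matrix `A(Φ_s)` at a point with coordinates in a commutative ring. -/
def hasseWittEval {R : Type*} [CommRing R] (p q g s : ℕ) (z : Fin (g * q + 1) → R) :
    Matrix (Fin g) (Fin g) R := (hasseWitt p q g s).map (evalInt z)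

/-- The matrix `I_s` at a point with coordinates in a commutative ring. -/
def solEval {R : Type*} [CommRing R] (p q g s : ℕ) (z : Fin (g * q + 1) → R) :
    Matrix (Fin (g * q + 1)) (Fin g) R := (solMatrix p q g s).map (evalInt z)

theorem map_hasseWittEval {R S : Type*} [CommRing R] [CommRing S] (φ : R →+* S) (p q g s : ℕ)
    (z : Fin (g * q + 1) → R) :
    (hasseWittEval p q g s z).map φ = hasseWittEval p q g s (fun i => φ (z i)) := by
  ext u v; simp [hasseWittEval, map_evalInt]

theorem map_solEval {R S : Type*} [CommRing R] [CommRing S] (φ : R →+* S) (p q g s : ℕ)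
    (z : Fin (g * q + 1) → R) :
    (solEval p q g s z).map φ = solEval p q g s (fun i => φ (z i)) := by
  ext u v; simp [solEval, map_evalInt]

/-- The exponent of the master polynomial `Φ_s`. -/
def expo (p q s : ℕ) : ℕ := (p ^ (ord p q * s) - 1) / q

theorem ord_pos {p q : ℕ} (hp : p.Prime) (hq : q.Prime) (hqp : q < p) : 0 < ord p q := by
  have := Fact.mk hq
  rw [ord, orderOf_pos_iff, isOfFinOrder_iff_isUnit]
  rw [ZMod.isUnit_iff_coprime]
  exact (Nat.coprime_primes hp hq).2 hqp.ne'

theorem q_mul_expo {p q : ℕ} (hp : p.Prime) (s : ℕ) :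
    q * expo p q s + 1 = (p ^ ord p q) ^ s := by
  have h1 : q ∣ p ^ (ord p q * s) - 1 := by
    rw [← ZMod.natCast_eq_zero_iff, Nat.cast_sub (Nat.one_le_pow _ _ hp.pos)]
    push_cast
    rw [pow_mul, ord, pow_orderOf_eq_one]
    simp
  rw [expo, Nat.mul_div_cancel' h1, Nat.sub_add_cancel (Nat.one_le_pow _ _ hp.pos), pow_mul]

/-- This gives Φ_{s+1} = Φ_s · Φ_1^{Q^s}, used for the Dwork congruence; `expo_succ'` gives Φ_{s+1}
= Φ_1 · Φ_s^Q, used with Frobenius. -/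
theorem expo_succ {p q : ℕ} (hp : p.Prime) (hq : 0 < q) (s : ℕ) :
    expo p q (s + 1) = expo p q s + expo p q 1 * (p ^ ord p q) ^ s := by
  have h1 := q_mul_expo (q := q) hp (s + 1)
  have h2 := q_mul_expo (q := q) hp s
  have h3 := q_mul_expo (q := q) hp 1
  rw [pow_one] at h3
  apply Nat.eq_of_mul_eq_mul_left hq
  have h4 : q * (expo p q s + expo p q 1 * (p ^ ord p q) ^ s) + 1
      = (q * expo p q 1 + 1) * (p ^ ord p q) ^ s := by
    rw [mul_add, add_right_comm, h2]; ring
  rw [h3] at h4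
  have h5 : p ^ ord p q * (p ^ ord p q) ^ s = (p ^ ord p q) ^ (s + 1) := by ring
  omega

theorem expo_succ' {p q : ℕ} (hp : p.Prime) (hq : 0 < q) (s : ℕ) :
    expo p q (s + 1) = expo p q 1 + expo p q s * p ^ ord p q := by
  have h1 := q_mul_expo (q := q) hp (s + 1)
  have h2 := q_mul_expo (q := q) hp s
  have h3 := q_mul_expo (q := q) hp 1
  rw [pow_one] at h3
  apply Nat.eq_of_mul_eq_mul_left hq
  have h4 : q * (expo p q 1 + expo p q s * p ^ ord p q) + 1
      = (q * expo p q s + 1) * p ^ ord p q := by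
    rw [mul_add, add_right_comm, h3]; ring
  rw [h2] at h4
  have h5 : (p ^ ord p q) ^ s * p ^ ord p q = (p ^ ord p q) ^ (s + 1) := by ring
  omega

theorem expo_pos {p q : ℕ} (hp : p.Prime) (hq : q.Prime) (hqp : q < p) {s : ℕ} (hs : 0 < s) :
    0 < expo p q s := by
  have h1 := q_mul_expo (q := q) hp s
  rw [← pow_mul] at h1
  have h2 : 1 < p ^ (ord p q * s) :=
    Nat.one_lt_pow (Nat.mul_pos (ord_pos hp hq hqp) hs).ne' hp.one_lt
  by_contra! h
  have : expo p q s = 0 := by omega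
  rw [this] at h1
  omega

theorem master_map {R : Type*} [CommRing R] (p q g s : ℕ) (z : Fin (g * q + 1) → R) :
    (master p q g s).map (evalInt z) = Lagrange.nodal Finset.univ z ^ expo p q s := by
  simp [master, expo, Lagrange.nodal, Polynomial.map_prod, evalInt_X]

theorem hasseWittEval_apply {R : Type*} [CommRing R] (p q g s : ℕ) (z : Fin (g * q + 1) → R)
    (u v : Fin g) :
    hasseWittEval p q g s z u v = (Lagrange.nodal Finset.univ z ^ expo p q s).coeff
      (p ^ (ord p q * s) * ((v : ℕ) + 1) - ((u : ℕ) + 1)) := by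
  simp [hasseWittEval, hasseWitt, ← master_map]

theorem solEval_apply {R : Type*} [CommRing R] {p q g s : ℕ} (hs : 0 < expo p q s)
    (z : Fin (g * q + 1) → R) (i : Fin (g * q + 1)) (l : Fin g) :
    solEval p q g s z i l = (Lagrange.nodal (Finset.univ.erase i) z *
      Lagrange.nodal Finset.univ z ^ (expo p q s - 1)).coeff
      (((l : ℕ) + 1) * p ^ (ord p q * s) - 1) := by
  have h : (master p q g s /ₘ (X - C (MvPolynomial.X i))).map (evalInt z) =
      Lagrange.nodal (Finset.univ.erase i) z *
      Lagrange.nodal Finset.univ z ^ (expo p q s - 1) := by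
    rw [Polynomial.map_divByMonic _ (monic_X_sub_C _), master_map]
    have : (X - C (MvPolynomial.X i : MvPolynomial (Fin (g * q + 1)) ℤ)).map (evalInt z)
        = X - C (z i) := by simp [evalInt_X]
    rw [this]
    have h2 : Lagrange.nodal Finset.univ z ^ expo p q s =
        (X - C (z i)) * (Lagrange.nodal (Finset.univ.erase i) z *
          Lagrange.nodal Finset.univ z ^ (expo p q s - 1)) := by
      rw [← mul_assoc, ← Lagrange.nodal_eq_mul_nodal_erase (Finset.mem_univ i), ← pow_succ',
        Nat.sub_add_cancel hs]
    rw [h2, mul_divByMonic_cancel_left _ (monic_X_sub_C _)]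
  simp [solEval, solMatrix, ← h]

end

section

open Polynomial

/-! ### The Dwork congruence -/

/-- The polynomials whose coefficients at the multiples of `Q ^ s` are the entries of the row
`I_s(i) - T * A_s`. -/
def residual {R : Type*} [CommRing R] (p q g : ℕ) (z : Fin (g * q + 1) → R)
    (i : Fin (g * q + 1)) (T : Fin g → R) (s : ℕ) : R[X] :=
  X * (Lagrange.nodal (Finset.univ.erase i) z * Lagrange.nodal Finset.univ z ^ (expo p q s - 1)) -
    ∑ u : Fin g, C (T u) * (X ^ ((u : ℕ) + 1) * Lagrange.nodal Finset.univ z ^ expo p q s)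

/-- The factors X and X^{u+1} move the exponents lQ^s - 1 and lQ^s - u of the two matrices to the
common value lQ^s (u, l counted from one); g ≤ Q^s prevents truncated subtraction. -/
theorem residual_coeff {R : Type*} [CommRing R] {p q g s : ℕ} (hs : 0 < expo p q s)
    (hgs : g ≤ (p ^ ord p q) ^ s) (z : Fin (g * q + 1) → R) (i : Fin (g * q + 1)) (T : Fin g → R)
    (l : Fin g) :
    (residual p q g z i T s).coeff ((p ^ ord p q) ^ s * ((l : ℕ) + 1)) =
      solEval p q g s z i l - ∑ u, T u * hasseWittEval p q g s z u l := by
  have h0 : (p ^ ord p q) ^ s ≤ (p ^ ord p q) ^ s * ((l : ℕ) + 1) :=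
    Nat.le_mul_of_pos_right _ (Nat.succ_pos _)
  have hl := l.2
  rw [residual, coeff_sub, finsetSum_coeff, solEval_apply hs]
  congr 1
  · obtain ⟨d, hd⟩ : ∃ d, (p ^ ord p q) ^ s * ((l : ℕ) + 1) = d + 1 :=
      Nat.exists_eq_add_of_le' (by omega)
    rw [hd, coeff_X_mul, pow_mul, mul_comm ((l : ℕ) + 1), hd, Nat.add_sub_cancel]
  · refine Finset.sum_congr rfl fun u _ => ?_
    have hu := u.2
    rw [coeff_C_mul, hasseWittEval_apply, coeff_X_pow_mul', if_pos (by omega), pow_mul]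

theorem natDegree_nodal_pow_le {R ι : Type*} [CommRing R] (S : Finset ι) (z : ι → R) (N : ℕ) :
    (Lagrange.nodal S z ^ N).natDegree ≤ S.card * N := by
  refine natDegree_pow_le.trans ?_
  rw [mul_comm]
  refine Nat.mul_le_mul_right _ ?_
  refine (natDegree_prod_le _ _).trans ?_
  calc _ ≤ ∑ i ∈ S, 1 := Finset.sum_le_sum fun i _ => natDegree_X_sub_C_le _
    _ = _ := by simp

/-- The matrices see every multiple of Q^s that matters: the residual has no constant term, and its
degree is at most (gq+1)N_s + g < (g+1)Q^s. -/
theorem residual_coeff_eq_zero {R : Type*} [CommRing R] {p q g s m : ℕ} (hp : p.Prime)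
    (hs : 0 < expo p q s) (hq : 0 < q) (hm : m = 0 ∨ g + 1 ≤ m) (z : Fin (g * q + 1) → R)
    (i : Fin (g * q + 1)) (T : Fin g → R) :
    (residual p q g z i T s).coeff ((p ^ ord p q) ^ s * m) = 0 := by
  rcases hm with rfl | hm
  · simp [residual, finsetSum_coeff]
  have hN := q_mul_expo (q := q) hp s
  have hbig : (g * q + 1) * expo p q s + g < (p ^ ord p q) ^ s * m := by
    calc _ < (g + 1) * (p ^ ord p q) ^ s := by
            rw [← hN]
            have h1 : expo p q s ≤ q * expo p q s := Nat.le_mul_of_pos_left _ hq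
            nlinarith
      _ ≤ _ := by rw [mul_comm]; exact Nat.mul_le_mul_left _ hm
  have hexp : (g * q + 1) * expo p q s = (g * q + 1) * (expo p q s - 1) + (g * q + 1) := by
    rw [← Nat.mul_succ, Nat.succ_eq_add_one, Nat.sub_add_cancel hs]
  rw [residual, coeff_sub, finsetSum_coeff, sub_eq_zero]
  rw [Finset.sum_eq_zero]
  · apply coeff_eq_zero_of_natDegree_lt
    refine lt_of_le_of_lt ?_ hbig
    refine natDegree_mul_le.trans ?_
    have h1 := natDegree_nodal_pow_le (R := R) (Finset.univ.erase i) z 1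
    have h2 := natDegree_nodal_pow_le (R := R) Finset.univ z (expo p q s - 1)
    rw [Finset.card_erase_of_mem (Finset.mem_univ i), pow_one] at h1
    simp only [Finset.card_univ, Fintype.card_fin] at h1 h2
    have h3 := natDegree_mul_le (p := Lagrange.nodal (Finset.univ.erase i) z)
      (q := Lagrange.nodal Finset.univ z ^ (expo p q s - 1))
    have h4 := natDegree_X_le (R := R)
    omega
  · intro u _
    have hu := u.2
    rw [coeff_C_mul, coeff_X_pow_mul', if_pos (by omega), coeff_eq_zero_of_natDegree_lt, mul_zero]
    have h2 := natDegree_nodal_pow_le (R := R) Finset.univ z (expo p q s)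
    simp only [Finset.card_univ, Fintype.card_fin] at h2
    omega

theorem residual_succ {R : Type*} [CommRing R] {p q g s : ℕ} (hp : p.Prime) (hq : 0 < q)
    (hs : 0 < expo p q s) (z : Fin (g * q + 1) → R) (i : Fin (g * q + 1)) (T : Fin g → R) :
    residual p q g z i T (s + 1) = residual p q g z i T s *
      (Lagrange.nodal Finset.univ z ^ expo p q 1) ^ (p ^ ord p q) ^ s := by
  have h1 := expo_succ hp hq s
  rw [residual, residual, ← pow_mul, sub_mul, Finset.sum_mul]
  congr 1
  · rw [h1, show expo p q s + expo p q 1 * (p ^ ord p q) ^ s - 1 =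
      (expo p q s - 1) + expo p q 1 * (p ^ ord p q) ^ s by omega, pow_add]
    ring
  · refine Finset.sum_congr rfl fun u _ => ?_
    rw [h1, pow_add]
    ring

/-- The hypothesis controls the residual of index j only at multiples of Q^j. The lower levels are
inherited from index j - 1, since `residual_succ` multiplies by a Q^{j-1}-th power. One more such
multiplication reaches s + 1. -/
theorem dvd_residual_succ {R : Type*} [CommRing R] {p q g : ℕ} (hp : p.Prime) (hq : q.Prime)
    (hqp : q < p) (hpe : g * q + 1 < p ^ ord p q) (hreg : (p : R) ∈ nonZeroDivisors R)
    (z : Fin (g * q + 1) → R) (i : Fin (g * q + 1)) (T : Fin g → R) {s : ℕ} (hs : 0 < s)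
    (h : ∀ j, 0 < j → j ≤ s → ∀ l, (p : R) ^ j ∣
      solEval p q g j z i l - ∑ u, T u * hasseWittEval p q g j z u l) (l : Fin g) :
    (p : R) ^ s ∣
      solEval p q g (s + 1) z i l - ∑ u, T u * hasseWittEval p q g (s + 1) z u l := by
  have hg : ∀ s, 0 < s → g ≤ (p ^ ord p q) ^ s := fun s hs => by
    have h1 : p ^ ord p q ≤ (p ^ ord p q) ^ s := Nat.le_self_pow hs.ne' _
    have h2 : g ≤ g * q := Nat.le_mul_of_pos_right _ hq.pos
    omega
  have key : ∀ j, 0 < j → j ≤ s →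
      CoeffDvd p (p ^ ord p q) j (residual p q g z i T j) := by
    intro j hj
    have top : ∀ j, 0 < j → j ≤ s → ∀ k, (p ^ ord p q) ^ j ∣ k →
        (p : R) ^ j ∣ (residual p q g z i T j).coeff k := by
      rintro j hj hjs _ ⟨m, rfl⟩
      by_cases hm : m = 0 ∨ g + 1 ≤ m
      · rw [residual_coeff_eq_zero hp (expo_pos hp hq hqp hj) hq.pos hm]
        exact dvd_zero _
      · obtain ⟨l, rfl⟩ : ∃ l : Fin g, m = l + 1 := ⟨⟨m - 1, by omega⟩, by simp; omega⟩
        rw [residual_coeff (expo_pos hp hq hqp hj) (hg j hj)]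
        exact h j hj hjs l
    induction j, hj using Nat.le_induction with
    | base =>
      intro h1 i' hi' k hk
      rcases Nat.le_one_iff_eq_zero_or_eq_one.1 hi' with rfl | rfl
      · simp
      · exact top 1 one_pos h1 k hk
    | succ j hj ih =>
      intro hjs i' hi' k hk
      rcases hi'.eq_or_lt with rfl | hlt
      · exact top _ (Nat.succ_pos _) hjs k hk
      · rw [residual_succ hp hq.pos (expo_pos hp hq hqp hj)]
        exact (ih (by omega)).mul_pow hp (ord_pos hp hq hqp) hreg _ i' (by omega) k hk
  rw [← residual_coeff (expo_pos hp hq hqp (Nat.succ_pos s)) (hg _ (Nat.succ_pos s)),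
    residual_succ hp hq.pos (expo_pos hp hq hqp hs)]
  refine (key s hs le_rfl).mul_pow hp (ord_pos hp hq hqp) hreg _ s le_rfl _ ?_
  rw [pow_succ, mul_assoc]
  exact dvd_mul_right _ _

/-- The matrix `I_s * A(Φ_s)⁻¹` at a point with coordinates in a commutative ring. -/
def approxEval {R : Type*} [CommRing R] (p q g s : ℕ) (z : Fin (g * q + 1) → R) :
    Matrix (Fin (g * q + 1)) (Fin g) R :=
  solEval p q g s z * (hasseWittEval p q g s z)⁻¹

theorem approxEval_mul {R : Type*} [CommRing R] {p q g s : ℕ} {z : Fin (g * q + 1) → R}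
    (h : IsUnit (hasseWittEval p q g s z).det) :
    approxEval p q g s z * hasseWittEval p q g s z = solEval p q g s z := by
  rw [approxEval, Matrix.mul_assoc, Matrix.nonsing_inv_mul _ h, Matrix.mul_one]

/-- The matrix inverse is zero when the determinant is not a unit, so it commutes with φ only under
invertibility. -/
theorem map_approxEval {R S : Type*} [CommRing R] [CommRing S] (φ : R →+* S) {p q g s : ℕ}
    {z : Fin (g * q + 1) → R} (h : IsUnit (hasseWittEval p q g s z).det) :
    (approxEval p q g s z).map φ = approxEval p q g s (fun i => φ (z i)) := by
  have h2 : IsUnit (hasseWittEval p q g s (fun i => φ (z i))).det := by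
    rw [← map_hasseWittEval, ← RingHom.mapMatrix_apply, ← RingHom.map_det]
    exact h.map φ
  have h3 := congrArg (fun M => M.map φ) (approxEval_mul h)
  simp only [Matrix.map_mul] at h3
  rw [map_hasseWittEval, map_solEval, ← approxEval_mul h2] at h3
  have h4 := congrArg (fun M => M * (hasseWittEval p q g s (fun i => φ (z i)))⁻¹) h3
  simpa only [Matrix.mul_assoc, Matrix.mul_nonsing_inv _ h2, Matrix.mul_one] using h4

theorem pow_dvd_sub_of_le {R : Type*} [CommRing R] {p : R} {x : ℕ → R} {a b : ℕ}
    (hab : a ≤ b) (h : ∀ s, a ≤ s → s < b → p ^ s ∣ x (s + 1) - x s) : p ^ a ∣ x b - x a := by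
  induction b, hab using Nat.le_induction with
  | base => simp
  | succ b hab ih =>
    have h1 := ih fun s hs hsb => h s hs (by omega)
    have h2 := (pow_dvd_pow p hab).trans (h b hab (by omega))
    have := dvd_add h2 h1
    rwa [sub_add_sub_cancel] at this

/-- Take for T the row of I_s A_s⁻¹. For j ≤ s, I_j - T A_j = (I_j A_j⁻¹ - I_s A_s⁻¹) A_j is
divisible by p^j, by telescoping the earlier congruences. `dvd_residual_succ` then applies, and
multiplication by A_{s+1}⁻¹ finishes. -/
theorem pow_dvd_approxEval_succ_sub {R : Type*} [CommRing R] {p q g : ℕ} (hp : p.Prime)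
    (hq : q.Prime) (hqp : q < p) (hpe : g * q + 1 < p ^ ord p q)
    (hreg : (p : R) ∈ nonZeroDivisors R) {z : Fin (g * q + 1) → R}
    (hz : ∀ s, 0 < s → IsUnit (hasseWittEval p q g s z).det) {s : ℕ} (hs : 0 < s)
    (i : Fin (g * q + 1)) (l : Fin g) :
    (p : R) ^ s ∣ approxEval p q g (s + 1) z i l - approxEval p q g s z i l := by
  induction s using Nat.strong_induction_on generalizing l with
  | _ s ih =>
    have h1 : ∀ j, 0 < j → j ≤ s → ∀ l, (p : R) ^ j ∣
        solEval p q g j z i l - ∑ u, approxEval p q g s z i u * hasseWittEval p q g j z u l := by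
      intro j hj hjs l
      rw [← approxEval_mul (hz j hj), Matrix.mul_apply, ← Finset.sum_sub_distrib]
      refine Finset.dvd_sum fun u _ => ?_
      rw [← sub_mul, ← neg_sub, neg_mul, dvd_neg]
      refine Dvd.dvd.mul_right ?_ _
      exact pow_dvd_sub_of_le (x := fun s => approxEval p q g s z i u) hjs
        fun r hr hrs => ih r hrs (by omega) u
    have h2 := dvd_residual_succ hp hq hqp hpe hreg z i _ hs h1
    have h3 : ∀ l, solEval p q g (s + 1) z i l -
        ∑ u, approxEval p q g s z i u * hasseWittEval p q g (s + 1) z u l =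
        ((approxEval p q g (s + 1) z - approxEval p q g s z) *
          hasseWittEval p q g (s + 1) z) i l := by
      intro l
      rw [Matrix.sub_mul, approxEval_mul (hz _ (Nat.succ_pos s)), Matrix.sub_apply,
        Matrix.mul_apply]
    have h4 : approxEval p q g (s + 1) z i l - approxEval p q g s z i l =
        ∑ k, ((approxEval p q g (s + 1) z - approxEval p q g s z) *
          hasseWittEval p q g (s + 1) z) i k * (hasseWittEval p q g (s + 1) z)⁻¹ k l := by
      rw [← Matrix.mul_apply, Matrix.mul_assoc,
        Matrix.mul_nonsing_inv _ (hz _ (Nat.succ_pos s)), Matrix.mul_one, Matrix.sub_apply]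
    rw [h4]
    exact Finset.dvd_sum fun k _ => ((h3 k) ▸ h2 k).mul_right _

/-! ### Frobenius and the Hasse-Witt determinants modulo `p` -/

/-- The rows of A(Φ_1) are the coefficients of the Cartier operator: by the degree bound only the
exponents Q, …, gQ survive the contraction. -/
theorem contract_X_pow_mul_nodal {R : Type*} [CommRing R] {p q g : ℕ} (hp : p.Prime)
    (hq : 0 < q) (hpe : g * q + 1 < p ^ ord p q) (z : Fin (g * q + 1) → R) (u : Fin g) :
    contract (p ^ ord p q) (X ^ ((u : ℕ) + 1) * Lagrange.nodal Finset.univ z ^ expo p q 1) =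
      ∑ k : Fin g, C (hasseWittEval p q g 1 z u k) * X ^ ((k : ℕ) + 1) := by
  have hu := u.2
  have hQ : p ^ ord p q ≠ 0 := (pow_pos hp.pos _).ne'
  have hgq : g ≤ g * q := Nat.le_mul_of_pos_right _ hq
  have hN := q_mul_expo (q := q) hp 1
  rw [pow_one] at hN
  ext m
  rw [coeff_contract hQ, finsetSum_coeff]
  simp only [coeff_C_mul, coeff_X_pow, mul_ite, mul_one, mul_zero]
  by_cases hm : m = 0 ∨ g + 1 ≤ m
  · rw [Finset.sum_eq_zero fun k _ => if_neg (by have := k.2; omega)]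
    rcases hm with rfl | hm
    · simp
    · have hbig : (g * q + 1) * expo p q 1 + g < m * p ^ ord p q := by
        calc _ < (g + 1) * p ^ ord p q := by
                rw [← hN]
                have h1 : expo p q 1 ≤ q * expo p q 1 := Nat.le_mul_of_pos_left _ hq
                nlinarith
          _ ≤ _ := Nat.mul_le_mul_right _ hm
      have h2 := natDegree_nodal_pow_le (R := R) Finset.univ z (expo p q 1)
      simp only [Finset.card_univ, Fintype.card_fin] at h2
      rw [coeff_X_pow_mul', if_pos (by omega), coeff_eq_zero_of_natDegree_lt (by omega)]
  · obtain ⟨k, rfl⟩ : ∃ k : Fin g, m = k + 1 := ⟨⟨m - 1, by omega⟩, by simp; omega⟩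
    rw [Finset.sum_eq_single k (fun j _ hj => if_neg fun h => hj (Fin.ext (by omega))) (by simp),
      if_pos rfl, hasseWittEval_apply, coeff_X_pow_mul', mul_one, mul_comm (p ^ ord p q)]
    have : p ^ ord p q ≤ ((k : ℕ) + 1) * p ^ ord p q := Nat.le_mul_of_pos_left _ (Nat.succ_pos _)
    rw [if_pos (by omega)]

/-- In characteristic p, Φ_s^Q is a Frobenius twist of Φ_s evaluated at t^Q, so it can be pulled out
of the contraction of t^u Φ_1 Φ_s^Q. -/
theorem hasseWittEval_succ {R : Type*} [CommRing R] {p q g : ℕ} [CharP R p] (hp : p.Prime)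
    (hq : q.Prime) (hpe : g * q + 1 < p ^ ord p q) (z : Fin (g * q + 1) → R)
    {s : ℕ} (hs : 0 < s) :
    hasseWittEval p q g (s + 1) z = hasseWittEval p q g 1 z *
      (hasseWittEval p q g s z).map (· ^ p ^ ord p q) := by
  have : ExpChar R p := ExpChar.prime hp
  have hQ : p ^ ord p q ≠ 0 := (pow_pos hp.pos _).ne'
  have hgq : g ≤ g * q := Nat.le_mul_of_pos_right _ hq.pos
  have hsQ : p ^ ord p q ≤ (p ^ ord p q) ^ s := Nat.le_self_pow hs.ne' _
  ext u v
  have hu := u.2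
  have h1 : (p ^ ord p q) ^ s ≤ (p ^ ord p q) ^ s * ((v : ℕ) + 1) :=
    Nat.le_mul_of_pos_right _ (Nat.succ_pos _)
  have h2 : (p ^ ord p q) ^ s * ((v : ℕ) + 1) ≤ (p ^ ord p q) ^ s * ((v : ℕ) + 1) * p ^ ord p q :=
    Nat.le_mul_of_pos_right _ (pow_pos hp.pos _)
  set F := Lagrange.nodal Finset.univ z with hF
  have h3 : X ^ ((u : ℕ) + 1) * F ^ expo p q (s + 1) = X ^ ((u : ℕ) + 1) * F ^ expo p q 1 *
      expand R (p ^ ord p q) ((F ^ expo p q s).map (iterateFrobenius R p (ord p q))) := by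
    rw [← map_expand, map_iterateFrobenius_expand, expo_succ' hp hq.pos]
    ring
  have h4 : hasseWittEval p q g (s + 1) z u v = (contract (p ^ ord p q)
      (X ^ ((u : ℕ) + 1) * F ^ expo p q (s + 1))).coeff ((p ^ ord p q) ^ s * ((v : ℕ) + 1)) := by
    rw [coeff_contract hQ, coeff_X_pow_mul', if_pos (by omega), hasseWittEval_apply]
    congr 2
    ring
  rw [h4, h3, contract_mul_expand hQ, contract_X_pow_mul_nodal hp hq.pos hpe, Finset.sum_mul,
    finsetSum_coeff, Matrix.mul_apply]
  refine Finset.sum_congr rfl fun k _ => ?_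
  have hk := k.2
  rw [mul_assoc, coeff_C_mul, coeff_X_pow_mul', if_pos (by omega), coeff_map,
    iterateFrobenius_def, Matrix.map_apply, hasseWittEval_apply p q g s, pow_mul]

theorem isUnit_det_hasseWittEval_of_charP {R : Type*} [CommRing R] {p q g : ℕ} [CharP R p]
    (hp : p.Prime) (hq : q.Prime) (hpe : g * q + 1 < p ^ ord p q)
    {z : Fin (g * q + 1) → R} (h1 : IsUnit (hasseWittEval p q g 1 z).det) {s : ℕ} (hs : 0 < s) :
    IsUnit (hasseWittEval p q g s z).det := by
  have : ExpChar R p := ExpChar.prime hp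
  induction s, hs using Nat.le_induction with
  | base => exact h1
  | succ s hs ih =>
    rw [hasseWittEval_succ hp hq hpe z hs, Matrix.det_mul]
    refine h1.mul ?_
    have := RingHom.map_det (iterateFrobenius R p (ord p q)) (hasseWittEval p q g s z)
    have h2 : (iterateFrobenius R p (ord p q)).mapMatrix (hasseWittEval p q g s z) =
        (hasseWittEval p q g s z).map (· ^ p ^ ord p q) := by
      ext; simp [iterateFrobenius_def]
    rw [← h2, ← this]
    exact ih.map _

end

section

open Polynomial

/-! ### Power sum relations between `I_s` and `A(Φ_s)` -/

/-- Expand q(X^k F^N)', whose coefficient at M is divisible by M + 1 and hence by Q. Writing X^k =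
z_i^k + (X^k - z_i^k) in each summand of F' separates multiples of F/(X - z_i) from multiples of F.
For k = 0 the truncated exponent k - 1 is harmless because of the factor k. -/
theorem dvd_power_sum_relation {R ι : Type*} [CommRing R] [Fintype ι] [DecidableEq ι]
    {q N M Q : ℕ} (hQ : q * N + 1 = Q) (hN : 0 < N) (hM : Q ∣ M + 1) (z : ι → R) (k : ℕ) :
    (Q : R) ∣ q * k * (X ^ (k - 1) * Lagrange.nodal Finset.univ z ^ N).coeff M -
      ∑ j ∈ Finset.range k,
        (∑ i, z i ^ (k - 1 - j)) * (X ^ j * Lagrange.nodal Finset.univ z ^ N).coeff M -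
      ∑ i, z i ^ k * (Lagrange.nodal (Finset.univ.erase i) z *
        Lagrange.nodal Finset.univ z ^ (N - 1)).coeff M := by
  set F := Lagrange.nodal Finset.univ z with hF
  set G := fun i => Lagrange.nodal (Finset.univ.erase i) z with hG
  have h1 : ∀ i, X ^ k * G i * F ^ (N - 1) = C (z i ^ k) * (G i * F ^ (N - 1)) +
      ∑ j ∈ Finset.range k, C (z i ^ (k - 1 - j)) * (X ^ j * F ^ N) := by
    intro i
    have h2 : F ^ N = (X - C (z i)) * (G i * F ^ (N - 1)) := by
      rw [← mul_assoc, ← Lagrange.nodal_eq_mul_nodal_erase (Finset.mem_univ i), ← pow_succ',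
        Nat.sub_add_cancel hN]
    have h3 := (Commute.all (X : R[X]) (C (z i))).geom_sum₂_mul k
    have h4 : ∑ j ∈ Finset.range k, C (z i ^ (k - 1 - j)) * (X ^ j * F ^ N) =
        (∑ j ∈ Finset.range k, X ^ j * C (z i) ^ (k - 1 - j)) * (X - C (z i)) *
          (G i * F ^ (N - 1)) := by
      rw [h2, mul_assoc, Finset.sum_mul]
      refine Finset.sum_congr rfl fun j _ => ?_
      rw [C_pow]; ring
    rw [h4, h3, C_pow]
    ring
  have h5 : (q : R[X]) * derivative (X ^ k * F ^ N) = C (q * k : R) * (X ^ (k - 1) * F ^ N) +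
      C (q * N : R) * (∑ i, C (z i ^ k) * (G i * F ^ (N - 1)) +
        ∑ j ∈ Finset.range k, C (∑ i, z i ^ (k - 1 - j)) * (X ^ j * F ^ N)) := by
    have h6 : ∑ i, C (z i ^ k) * (G i * F ^ (N - 1)) +
        ∑ j ∈ Finset.range k, C (∑ i, z i ^ (k - 1 - j)) * (X ^ j * F ^ N) =
        X ^ k * F ^ (N - 1) * derivative F := by
      simp only [map_sum, Finset.sum_mul]
      rw [Finset.sum_comm, ← Finset.sum_add_distrib, hF, Lagrange.derivative_nodal, Finset.mul_sum]
      refine Finset.sum_congr rfl fun i _ => ?_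
      rw [← h1 i]
      ring
    rw [h6, derivative_mul, derivative_pow, derivative_pow, derivative_X]
    simp only [map_mul, map_natCast]
    ring
  have h7 := congrArg (fun P => coeff P M) h5
  simp only [← C_eq_natCast, coeff_C_mul, coeff_add, coeff_derivative, finsetSum_coeff] at h7
  have h8 : (q * N : R) = Q - 1 := by
    rw [← hQ]; push_cast; ring
  obtain ⟨d, hd⟩ := hM
  have h9 : (M : R) + 1 = Q * d := by exact_mod_cast congrArg (Nat.cast (R := R)) hd
  rw [h8, h9] at h7
  set S := ∑ i, z i ^ k * (G i * F ^ (N - 1)).coeff M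
  set U := ∑ j ∈ Finset.range k, (∑ i, z i ^ (k - 1 - j)) * (X ^ j * F ^ N).coeff M
  -- The quotient collects the coefficient of the derivative and the part of (Q - 1)(S + U)
  -- divisible by Q; the remaining -(S + U) is in the statement, since qN = Q - 1.
  refine ⟨q * (coeff (X ^ k * F ^ N) (M + 1) * d) - S - U, ?_⟩
  linear_combination -h7

/-- The lower triangular matrix that relates `A(Φ_s)` to the power sum combinations of the rows
of `I_s`. -/
def powerSumMatrix {R : Type*} [CommRing R] (q g : ℕ) (z : Fin (g * q + 1) → R) :
    Matrix (Fin g) (Fin g) R :=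
  Matrix.of fun u j => (if j = u then (q : R) * (((u : ℕ) + 1 : ℕ) : R) else 0) -
    if j ≤ u then ∑ i, z i ^ ((u : ℕ) - (j : ℕ)) else 0

/-- The matrix of powers of the coordinates. -/
def powerMatrix {R : Type*} [CommRing R] (q g : ℕ) (z : Fin (g * q + 1) → R) :
    Matrix (Fin g) (Fin (g * q + 1)) R := Matrix.of fun u i => z i ^ ((u : ℕ) + 1)

/-- The zeroth power sum is n = gq + 1, so the diagonal entry is q(u+1) - n. -/
theorem det_powerSumMatrix {R : Type*} [CommRing R] (q g : ℕ) (z : Fin (g * q + 1) → R) :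
    (powerSumMatrix q g z).det =
      ∏ u : Fin g, -((q * (g - ((u : ℕ) + 1)) + 1 : ℕ) : R) := by
  rw [Matrix.det_of_isLowerTriangular]
  · refine Finset.prod_congr rfl fun u _ => ?_
    obtain ⟨d, hd⟩ : ∃ d, g = (u + 1) + d := Nat.exists_eq_add_of_le u.2
    simp only [powerSumMatrix, Matrix.of_apply, if_true, le_refl, Nat.sub_self, pow_zero,
      Finset.sum_const, Finset.card_univ, Fintype.card_fin, nsmul_eq_mul, mul_one]
    rw [show g - ((u : ℕ) + 1) = d by omega]
    have : (g : R) = u + 1 + d := by exact_mod_cast congrArg (Nat.cast (R := R)) hd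
    push_cast
    rw [this]
    ring
  · intro u j huj
    have huj : u < j := huj
    simp [powerSumMatrix, huj.ne', not_le.2 huj]

theorem dvd_powerSumMatrix_mul_sub {R : Type*} [CommRing R] {p q g s : ℕ} (hp : p.Prime)
    (hq : q.Prime) (hqp : q < p) (hpe : g * q + 1 < p ^ ord p q) (hs : 0 < s)
    (z : Fin (g * q + 1) → R) (u l : Fin g) :
    (((p ^ ord p q) ^ s : ℕ) : R) ∣ (powerSumMatrix q g z * hasseWittEval p q g s z -
      powerMatrix q g z * solEval p q g s z) u l := by
  have hN := expo_pos hp hq hqp hs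
  have hQs : p ^ ord p q ≤ (p ^ ord p q) ^ s := Nat.le_self_pow hs.ne' _
  have hgq : g ≤ g * q := Nat.le_mul_of_pos_right _ hq.pos
  have hl : (p ^ ord p q) ^ s ≤ (p ^ ord p q) ^ s * ((l : ℕ) + 1) :=
    Nat.le_mul_of_pos_right _ (Nat.succ_pos _)
  have hu := u.2
  have h := dvd_power_sum_relation (q_mul_expo (q := q) hp s) hN
    (M := (p ^ ord p q) ^ s * ((l : ℕ) + 1) - 1)
    (by rw [Nat.sub_add_cancel (by omega)]; exact dvd_mul_right _ _) z ((u : ℕ) + 1)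
  have h1 : ∀ j : Fin g, (X ^ (j : ℕ) * Lagrange.nodal Finset.univ z ^ expo p q s).coeff
      ((p ^ ord p q) ^ s * ((l : ℕ) + 1) - 1) = hasseWittEval p q g s z j l := by
    intro j
    have hj := j.2
    rw [hasseWittEval_apply, coeff_X_pow_mul', if_pos (by omega), pow_mul]
    congr 1
    omega
  convert h using 1
  rw [Matrix.sub_apply, Matrix.mul_apply, Matrix.mul_apply]
  congr 1
  · simp only [powerSumMatrix, Matrix.of_apply, sub_mul, Finset.sum_sub_distrib, ite_mul, zero_mul,
      Finset.sum_ite_eq', Finset.mem_univ, if_true, Nat.add_sub_cancel]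
    rw [h1 u]
    congr 1
    rw [← Finset.sum_filter]
    refine Finset.sum_nbij (fun j => (j : ℕ)) ?_ ?_ ?_ ?_
    · intro j hj
      simpa [Nat.lt_succ_iff] using hj
    · exact fun a _ b _ hab => Fin.ext hab
    · intro j hj
      simp only [Finset.coe_range, Set.mem_Iio] at hj
      refine ⟨(⟨j, by omega⟩ : Fin g), ?_, rfl⟩
      simp only [Finset.coe_filter, Finset.mem_univ, true_and, Set.mem_ofPred_eq, Fin.le_def]
      omega
    · intro j _
      rw [h1 j]
  · refine Finset.sum_congr rfl fun i _ => ?_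
    rw [solEval_apply hN, powerMatrix, Matrix.of_apply, mul_comm ((l : ℕ) + 1), pow_mul]

theorem dvd_sum_solEval {R : Type*} [CommRing R] {p q g s : ℕ} (hp : p.Prime)
    (hq : q.Prime) (hqp : q < p) (hs : 0 < s)
    (z : Fin (g * q + 1) → R) (l : Fin g) :
    (((p ^ ord p q) ^ s : ℕ) : R) ∣ ∑ i, solEval p q g s z i l := by
  have hN := expo_pos hp hq hqp hs
  have hl : 0 < (p ^ ord p q) ^ s * ((l : ℕ) + 1) :=
    Nat.mul_pos (pow_pos (pow_pos hp.pos _) _) (Nat.succ_pos _)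
  have h := dvd_power_sum_relation (q_mul_expo (q := q) hp s) hN
    (M := (p ^ ord p q) ^ s * ((l : ℕ) + 1) - 1)
    (by rw [Nat.sub_add_cancel (by omega)]; exact dvd_mul_right _ _) z 0
  simp only [Nat.cast_zero, mul_zero, zero_mul, Finset.range_zero, Finset.sum_empty, sub_zero,
    zero_sub, pow_zero, one_mul, dvd_neg] at h
  convert h using 1
  refine Finset.sum_congr rfl fun i _ => ?_
  rw [solEval_apply hN, mul_comm ((l : ℕ) + 1), pow_mul]

/-! ### A point where the determinants do not vanish -/

/-- The Hasse-Witt matrix of a polynomial. -/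
def coeffMatrix {R : Type*} [CommRing R] (Q g : ℕ) (h : R[X]) : Matrix (Fin g) (Fin g) R :=
  Matrix.of fun u v => h.coeff (Q * ((v : ℕ) + 1) - ((u : ℕ) + 1))

/-- The entries of the last column lie at or above the degree of h, so that column is (0, …, 0, 1).
-/
theorem det_coeffMatrix_succ {R : Type*} [CommRing R] {Q r : ℕ} (hQ : 0 < Q) {h : R[X]}
    (hm : h.Monic) (hd : h.natDegree = (r + 1) * (Q - 1)) :
    (coeffMatrix Q (r + 1) h).det = (coeffMatrix Q r h).det := by
  obtain ⟨Q, rfl⟩ : ∃ k, Q = k + 1 := Nat.exists_eq_add_of_le' hQ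
  rw [Nat.add_sub_cancel] at hd
  have hexp : (Q + 1) * (r + 1) = (r + 1) * Q + (r + 1) := by ring
  rw [Matrix.det_succ_column _ (Fin.last r), Finset.sum_eq_single (Fin.last r)]
  · have h1 : coeffMatrix (Q + 1) (r + 1) h (Fin.last r) (Fin.last r) = 1 := by
      rw [coeffMatrix, Matrix.of_apply, Fin.val_last, hexp, Nat.add_sub_cancel, ← hd]
      exact hm
    rw [h1, ← two_mul, pow_mul]
    simp only [even_two, Even.neg_pow, one_pow, one_mul]
    congr 1
    ext u v
    simp [coeffMatrix, Fin.succAbove_last]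
  · intro u _ hu
    have hu' : (u : ℕ) < r := by
      have := u.2
      have : (u : ℕ) ≠ r := fun h => hu (Fin.ext h)
      omega
    have h1 : coeffMatrix (Q + 1) (r + 1) h u (Fin.last r) = 0 := by
      rw [coeffMatrix, Matrix.of_apply, Fin.val_last, hexp]
      exact coeff_eq_zero_of_natDegree_lt (by omega)
    rw [h1, mul_zero, zero_mul]
  · simp

/-- A new root is placed near infinity: up to a scalar (X - y)^c is (1 - wX)^c with w = 1/y, and the
determinant is a polynomial in w that is nonzero at w = 0. -/
theorem exists_det_coeffMatrix_mul_ne_zero {K : Type*} [Field K] [Infinite K] {Q r : ℕ} {h : K[X]}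
    (hh : (coeffMatrix Q r h).det ≠ 0) (c : ℕ) :
    ∃ y : K, (coeffMatrix Q r (h * (X - C y) ^ c)).det ≠ 0 := by
  let P : K[X][X] := h.map C * (1 - C X * X) ^ c
  let D : K[X] := (coeffMatrix Q r P).det
  have hD : ∀ w : K, D.eval w = (coeffMatrix Q r (h * (1 - C w * X) ^ c)).det := by
    intro w
    have h1 : P.map (evalRingHom w) = h * (1 - C w * X) ^ c := by
      have h2 : (evalRingHom w).comp C = RingHom.id K := by ext; simp
      simp [P, Polynomial.map_map, h2]
    rw [← coe_evalRingHom, RingHom.map_det, ← h1]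
    congr 1
    ext u v
    simp [coeffMatrix]
  -- The extra factor X forces w ≠ 0, so that y = w⁻¹ makes sense.
  have hX : X * D ≠ 0 := by
    refine mul_ne_zero X_ne_zero fun h0 => hh ?_
    have := hD 0
    rw [h0] at this
    simpa using this.symm
  obtain ⟨w, hw⟩ : ∃ w, (X * D).eval w ≠ 0 := by
    by_contra! hcon
    exact hX (Polynomial.funext fun w => by simp [hcon w])
  rw [eval_mul, eval_X] at hw
  have hw0 : w ≠ 0 := left_ne_zero_of_mul hw
  have hw1 := right_ne_zero_of_mul hw
  refine ⟨w⁻¹, fun h0 => hw1 ?_⟩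
  have h3 : h * (1 - C w * X) ^ c = C ((-w) ^ c) * (h * (X - C w⁻¹) ^ c) := by
    have h4 : (1 - C w * X : K[X]) = C (-w) * (X - C w⁻¹) := by
      rw [mul_sub, ← C_mul]
      simp [hw0]
      ring
    rw [h4, mul_pow, C_pow]
    ring
  have h5 : coeffMatrix Q r (C ((-w) ^ c) * (h * (X - C w⁻¹) ^ c)) =
      (-w) ^ c • coeffMatrix Q r (h * (X - C w⁻¹) ^ c) := by
    ext u v
    simp only [coeffMatrix, Matrix.of_apply, coeff_C_mul, Matrix.smul_apply, smul_eq_mul]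
  rw [hD, h3, h5, Matrix.det_smul, h0, mul_zero]

/-- Induction on the number of roots: the monic reduction drops the size by one, and the new root is
then added near infinity. The root 0 is kept throughout. -/
theorem exists_det_coeffMatrix_prod_ne_zero (K : Type*) [Field K] [Infinite K] {Q : ℕ} (hQ : 0 < Q)
    (r : ℕ) : ∃ w : ℕ → K, w 0 = 0 ∧
      (coeffMatrix Q (r + 1) (∏ j ∈ Finset.range (r + 1), (X - C (w j)) ^ (Q - 1))).det ≠ 0 := by
  have hmon : ∀ (w : ℕ → K) (r : ℕ),
      (∏ j ∈ Finset.range r, (X - C (w j)) ^ (Q - 1)).Monic := fun w r =>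
    monic_prod_of_monic _ _ fun j _ => (monic_X_sub_C _).pow _
  have hdeg : ∀ (w : ℕ → K) (r : ℕ),
      (∏ j ∈ Finset.range r, (X - C (w j)) ^ (Q - 1)).natDegree = r * (Q - 1) := by
    intro w r
    rw [natDegree_prod_of_monic _ _ fun j _ => (monic_X_sub_C _).pow _]
    simp [(monic_X_sub_C _).natDegree_pow]
  induction r with
  | zero =>
    refine ⟨fun _ => 0, rfl, ?_⟩
    rw [det_coeffMatrix_succ hQ (hmon _ _) (hdeg _ _), Matrix.det_fin_zero]
    exact one_ne_zero
  | succ r ih =>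
    obtain ⟨w, hw0, hw⟩ := ih
    obtain ⟨y, hy⟩ := exists_det_coeffMatrix_mul_ne_zero hw (Q - 1)
    refine ⟨Function.update w (r + 1) y, by simp [hw0], ?_⟩
    rw [det_coeffMatrix_succ hQ (hmon _ _) (hdeg _ _), Finset.prod_range_succ,
      Function.update_self]
    convert hy using 4
    refine Finset.prod_congr rfl fun j hj => ?_
    rw [Function.update_of_ne (Finset.mem_range.1 hj).ne]

theorem prod_range_mul_div {M : Type*} [CommMonoid M] {q : ℕ} (hq : 0 < q) (g : ℕ) (f : ℕ → M) :
    ∏ i ∈ Finset.range (g * q), f (i / q) = ∏ a ∈ Finset.range g, f a ^ q := by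
  induction g with
  | zero => simp
  | succ g ih =>
    rw [Nat.succ_mul, Finset.prod_range_add, ih, Finset.prod_range_succ]
    congr 1
    rw [Finset.prod_congr rfl (g := fun _ => f g), Finset.prod_const, Finset.card_range]
    intro i hi
    rw [mul_comm, Nat.mul_add_div hq, Nat.div_eq_of_lt (Finset.mem_range.1 hi), add_zero]

/-- The index of the cluster of equal coordinates that contains the coordinate `i`. -/
def cluster (q g : ℕ) (i : Fin (g * q + 1)) : ℕ := g - ((i : ℕ) + q - 1) / q

/-- Index 0 forms cluster g, and the later blocks of q indices form clusters g - 1, …, 0. The rows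
of the minor thus represent clusters 1, …, g once each. -/
theorem cluster_minorRow {q g : ℕ} (hq : 0 < q) (l : Fin g) :
    cluster q g (minorRow q g l) = l + 1 := by
  have hl := l.2
  rw [cluster, minorRow]
  dsimp only
  rw [Nat.add_sub_assoc hq, Nat.mul_add_div hq, Nat.div_eq_of_lt (by omega)]
  omega

theorem nodal_cluster {R : Type*} [CommRing R] {q : ℕ} (hq : 0 < q) (g : ℕ) (w : ℕ → R) :
    Lagrange.nodal Finset.univ (fun i => w (cluster q g i)) =
      (∏ j ∈ Finset.range g, (X - C (w j)) ^ q) * (X - C (w g)) := by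
  rw [Lagrange.nodal, Fin.prod_univ_succ, mul_comm]
  have h0 : cluster q g 0 = g := by
    simp [cluster, Nat.div_eq_of_lt (Nat.sub_lt hq one_pos)]
  rw [h0]
  congr 1
  rw [← Finset.prod_range_reflect, ← prod_range_mul_div hq g fun a => X - C (w (g - 1 - a)),
    ← Fin.prod_univ_eq_prod_range (fun i => X - C (w (g - 1 - i / q))) (g * q)]
  refine Finset.prod_congr rfl fun i _ => ?_
  have : cluster q g i.succ = g - 1 - (i : ℕ) / q := by
    rw [cluster, Fin.val_succ, show (i : ℕ) + 1 + q - 1 = i + q by omega, Nat.add_div_right _ hq]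
    omega
  rw [this]

/-- Since X - z_i is regular, deleting either of two equal factors leaves the same polynomial. -/
theorem solEval_congr {R : Type*} [CommRing R] {p q g s : ℕ} (hs : 0 < expo p q s)
    {z : Fin (g * q + 1) → R} {i i' : Fin (g * q + 1)} (h : z i = z i') (l : Fin g) :
    solEval p q g s z i l = solEval p q g s z i' l := by
  have h1 : Lagrange.nodal (Finset.univ.erase i) z = Lagrange.nodal (Finset.univ.erase i') z := by
    apply (monic_X_sub_C (z i)).isRegular.left
    dsimp only
    rw [← Lagrange.nodal_eq_mul_nodal_erase (Finset.mem_univ i), h,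
      ← Lagrange.nodal_eq_mul_nodal_erase (Finset.mem_univ i')]
  rw [solEval_apply hs, solEval_apply hs, h1]

/-- At the clustered point, rows of I_1 in one cluster agree and the cluster at 0 has zero powers.
So the power matrix times I_1 factors through the rows of the minor, while it also equals the
triangular matrix times A_1, which is invertible. -/
theorem exists_det_ne_zero_and_rowMinor_ne_zero (K : Type*) [Field K] [Infinite K] {p q g : ℕ}
    [CharP K p] (hp : p.Prime) (hq : q.Prime) (hqp : q < p) (hg : 0 < g)
    (hpe : g * q + 1 < p ^ ord p q) (hpn : (g * q + 1) + q ≤ p + 2) :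
    ∃ z : Fin (g * q + 1) → K, (hasseWittEval p q g 1 z).det ≠ 0 ∧
      rowMinor q g (solEval p q g 1 z) ≠ 0 := by
  have hQ : 0 < p ^ ord p q := pow_pos hp.pos _
  have hN := q_mul_expo (q := q) hp 1
  rw [pow_one] at hN
  have hN0 := expo_pos hp hq hqp one_pos
  obtain ⟨w, hw0, hw⟩ : ∃ w : ℕ → K, w 0 = 0 ∧
      (coeffMatrix (p ^ ord p q) g ((∏ j ∈ Finset.range g, (X - C (w j)) ^ (p ^ ord p q - 1)) *
        (X - C (w g)) ^ expo p q 1)).det ≠ 0 := by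
    obtain ⟨r, rfl⟩ : ∃ r, g = r + 1 := Nat.exists_eq_add_of_le' hg
    obtain ⟨w, hw0, hw⟩ := exists_det_coeffMatrix_prod_ne_zero K hQ r
    obtain ⟨y, hy⟩ := exists_det_coeffMatrix_mul_ne_zero hw (expo p q 1)
    refine ⟨Function.update w (r + 1) y, by simp [hw0], ?_⟩
    rw [Function.update_self]
    convert hy using 4
    refine Finset.prod_congr rfl fun j hj => ?_
    rw [Function.update_of_ne (Finset.mem_range.1 hj).ne]
  set z : Fin (g * q + 1) → K := fun i => w (cluster q g i) with hz
  have hA : hasseWittEval p q g 1 z = coeffMatrix (p ^ ord p q) g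
      ((∏ j ∈ Finset.range g, (X - C (w j)) ^ (p ^ ord p q - 1)) *
        (X - C (w g)) ^ expo p q 1) := by
    ext u v
    rw [hasseWittEval_apply, hz, nodal_cluster hq.pos, coeffMatrix, Matrix.of_apply, mul_one,
      mul_pow, ← Finset.prod_pow]
    simp only [← pow_mul, ← hN, Nat.add_sub_cancel]
  refine ⟨z, hA ▸ hw, fun hM => ?_⟩
  have h1 : powerSumMatrix q g z * hasseWittEval p q g 1 z =
      powerMatrix q g z * solEval p q g 1 z := by
    ext u l
    have h2 := dvd_powerSumMatrix_mul_sub hp hq hqp hpe one_pos z u l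
    have h3 : (((p ^ ord p q) ^ 1 : ℕ) : K) = 0 := by
      push_cast
      rw [CharP.cast_eq_zero, zero_pow (ord_pos hp hq hqp).ne', pow_one]
    rw [h3, zero_dvd_iff, Matrix.sub_apply, sub_eq_zero] at h2
    exact h2
  let Z : Matrix (Fin g) (Fin g) K := Matrix.of fun u c =>
    ∑ i, if cluster q g i = (c : ℕ) + 1 then z i ^ ((u : ℕ) + 1) else 0
  have h4 : powerMatrix q g z * solEval p q g 1 z =
      Z * (solEval p q g 1 z).submatrix (minorRow q g) id := by
    ext u l
    simp only [Matrix.mul_apply, Z, Matrix.of_apply, powerMatrix, Matrix.submatrix_apply, id,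
      Finset.sum_mul]
    rw [Finset.sum_comm]
    refine Finset.sum_congr rfl fun i _ => ?_
    simp only [ite_mul, zero_mul]
    rcases Nat.eq_zero_or_pos (cluster q g i) with h0 | h0
    · simp [hz, h0, hw0]
    · have hle : cluster q g i ≤ g := Nat.sub_le _ _
      rw [Finset.sum_eq_single (⟨cluster q g i - 1, by omega⟩ : Fin g)]
      · rw [if_pos (by dsimp only; omega)]
        congr 1
        apply solEval_congr hN0
        simp only [hz]
        rw [cluster_minorRow hq.pos, Nat.sub_add_cancel h0]
      · intro c _ hc
        rw [if_neg]
        intro h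
        exact hc (Fin.ext (by dsimp only; omega))
      · simp
  have h5 := congrArg Matrix.det (h1.trans h4)
  rw [rowMinor] at hM
  rw [Matrix.det_mul, Matrix.det_mul, hM, mul_zero, det_powerSumMatrix] at h5
  refine mul_ne_zero (Finset.prod_ne_zero_iff.2 fun u _ => ?_) (hA ▸ hw) h5
  -- The diagonal entries are positive integers at most gq - q + 1 ≤ p + 2 - 2q < p.
  rw [neg_ne_zero, Ne, CharP.cast_eq_zero_iff K p]
  intro hdvd
  have h6 := Nat.le_of_dvd (Nat.succ_pos _) hdvd
  have hu := u.2
  have h7 : q * (g - ((u : ℕ) + 1)) + q ≤ g * q := by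
    have : q * (g - ((u : ℕ) + 1)) + q = q * (g - (u : ℕ)) := by
      rw [← Nat.mul_succ]; congr 1; omega
    rw [this, mul_comm g]
    exact Nat.mul_le_mul_left _ (Nat.sub_le _ _)
  have := hq.two_le
  omega

end

/-! ### Monomials as multilinear maps -/

/-- Listing the variables of a monomial as a word makes it the diagonal of a multilinear map, with
no symmetrization and no factorials. -/
theorem exists_word_prod_eq {K ι : Type*} [CommMonoid K] (d : ι →₀ ℕ) {N : ℕ} (hd : d.degree = N) :
    ∃ w : Fin N → ι, ∀ y : ι → K, ∏ j, y (w j) = d.prod fun i e => y i ^ e := by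
  classical
  have hlen : d.toMultiset.toList.length = N := by
    rw [Multiset.length_toList, Finsupp.card_toMultiset, ← hd]
    rfl
  subst hlen
  refine ⟨fun j => d.toMultiset.toList.get j, fun y => ?_⟩
  rw [← List.prod_ofFn]
  have h1 : List.ofFn (fun j => y (d.toMultiset.toList.get j)) = d.toMultiset.toList.map y := by
    rw [← List.ofFn_get (l := d.toMultiset.toList.map y)]
    apply List.ext_get <;> simp
  rw [h1, ← Multiset.prod_coe, ← Multiset.map_coe, Multiset.coe_toList, Finsupp.toMultiset_map,
    Finsupp.prod_toMultiset]
  rw [Finsupp.prod_mapDomain_index (by simp) (by intros; rw [pow_add])]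

/-- A product of coordinates as a multilinear map. -/
def wordMap {K ι : Type*} [NontriviallyNormedField K] [Fintype ι] {N : ℕ} (w : Fin N → ι) :
    ContinuousMultilinearMap K (fun _ : Fin N => ι → K) K :=
  (ContinuousMultilinearMap.mkPiAlgebraFin K N K).compContinuousLinearMap
    fun j => ContinuousLinearMap.proj (w j)

theorem wordMap_apply {K ι : Type*} [NontriviallyNormedField K] [Fintype ι] {N : ℕ} (w : Fin N → ι) (y : Fin N → ι → K) :
    wordMap w y = ∏ j, y j (w j) := by
  simp [wordMap, List.prod_ofFn]

/-! ### The ring of integers of a complete ultrametric field -/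

section Integers

variable (K : Type*) [NontriviallyNormedField K] [IsUltrametricDist K]

/-- The closed unit ball of an ultrametric field. -/
abbrev Integers : ValuationSubring K := (NormedField.valuation (K := K)).valuationSubring

variable {K}

theorem mem_integers {x : K} : x ∈ Integers K ↔ ‖x‖ ≤ 1 := by
  rw [Valuation.mem_valuationSubring_iff, NormedField.valuation_apply, ← NNReal.coe_le_coe]
  rfl

theorem norm_integer_le_one (x : Integers K) : ‖x‖ ≤ 1 := mem_integers.1 x.2

theorem integer_dvd_iff {x y : Integers K} (hy : y ≠ 0) : y ∣ x ↔ ‖x‖ ≤ ‖y‖ := by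
  constructor
  · rintro ⟨c, rfl⟩
    calc ‖y * c‖ = ‖(y : K)‖ * ‖(c : K)‖ := norm_mul (y : K) (c : K)
      _ ≤ ‖(y : K)‖ * 1 := mul_le_mul_of_nonneg_left (norm_integer_le_one c) (norm_nonneg _)
      _ = ‖y‖ := mul_one _
  · intro h
    have hy' : (y : K) ≠ 0 := fun h0 => hy (Subtype.ext h0)
    have hc : (x : K) / y ∈ Integers K := by
      rw [mem_integers, norm_div]
      exact div_le_one_of_le₀ h (norm_nonneg _)
    refine ⟨⟨_, hc⟩, Subtype.ext ?_⟩
    change (x : K) = y * (x / y)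
    field_simp

theorem isUnit_integer_iff {x : Integers K} : IsUnit x ↔ ‖(x : K)‖ = 1 := by
  have h1 : ‖(1 : Integers K)‖ = 1 := norm_one (α := K)
  rw [isUnit_iff_dvd_one]
  constructor
  · intro h
    have hx : x ≠ 0 := by
      rintro rfl
      exact one_ne_zero (zero_dvd_iff.1 h)
    rw [integer_dvd_iff hx, h1] at h
    exact le_antisymm (norm_integer_le_one x) h
  · intro h
    have hx : x ≠ 0 := by
      rintro rfl
      simp at h
    rw [integer_dvd_iff hx, h1]
    exact h.ge

instance completeSpace_integers [CompleteSpace K] : CompleteSpace (Integers K) := by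
  refine IsClosed.completeSpace_coe (s := (Integers K : Set K)) (hs := ?_)
  have : (Integers K : Set K) = {x | ‖x‖ ≤ 1} := Set.ext fun x => mem_integers
  rw [this]
  exact isClosed_le continuous_norm continuous_const

/-- The closed balls around zero are ideals of the ring of integers. -/
def ballIdeal (r : {r : ℝ // 0 < r}) : Ideal (Integers K) where
  carrier := {x | ‖x‖ ≤ r}
  zero_mem' := by simpa using r.2.le
  add_mem' := fun {x y} hx hy => (IsUltrametricDist.norm_add_le_max x y).trans (max_le hx hy)
  smul_mem' := fun c x hx => by
    calc ‖c • x‖ = ‖(c : K)‖ * ‖(x : K)‖ := norm_mul (c : K) (x : K)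
      _ ≤ 1 * ‖(x : K)‖ := mul_le_mul_of_nonneg_right (norm_integer_le_one c) (norm_nonneg _)
      _ ≤ r := by rw [one_mul]; exact hx

/-- Evaluation of multivariate power series uses a neighbourhood basis of ideals; here these are the
closed balls around zero. -/
instance isLinearTopology_integers : IsLinearTopology (Integers K) (Integers K) := by
  refine IsLinearTopology.mk_of_hasBasis (Integers K) (p := fun _ : {r : ℝ // 0 < r} => True)
    (s := ballIdeal) ?_
  have h := Metric.nhds_basis_closedBall (x := (0 : Integers K))
  refine ⟨fun t => ?_⟩
  rw [h.mem_iff]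
  constructor
  · rintro ⟨r, hr, hrt⟩
    refine ⟨⟨r, hr⟩, trivial, fun x hx => hrt ?_⟩
    rw [mem_closedBall_zero_iff]
    exact hx
  · rintro ⟨r, -, hrt⟩
    refine ⟨r, r.2, fun x hx => hrt ?_⟩
    rw [mem_closedBall_zero_iff] at hx
    exact hx

theorem integer_pow_dvd_iff {p : ℕ} (hp0 : (p : K) ≠ 0) {x : Integers K} (s : ℕ) :
    (p : Integers K) ^ s ∣ x ↔ ‖(x : K)‖ ≤ ‖(p : K)‖ ^ s := by
  have h0 : (p : Integers K) ^ s ≠ 0 := pow_ne_zero _ fun h => hp0 (congrArg Subtype.val h)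
  rw [integer_dvd_iff h0]
  have : ‖(p : Integers K) ^ s‖ = ‖(p : K)‖ ^ s := norm_pow (p : K) s
  rw [this]
  rfl

theorem exists_integer_limit [CompleteSpace K] {p : ℕ} (hp0 : (p : K) ≠ 0) (hp1 : ‖(p : K)‖ < 1)
    {x : ℕ → Integers K} (hx : ∀ s, 0 < s → (p : Integers K) ^ s ∣ x (s + 1) - x s) :
    ∃ L, ∀ s, 0 < s → (p : Integers K) ^ s ∣ L - x s := by
  have h1 : ∀ n, dist (x n) (x (n + 1)) ≤ 1 * ‖(p : K)‖ ^ n := by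
    intro n
    rw [dist_comm, dist_eq_norm, one_mul]
    rcases Nat.eq_zero_or_pos n with rfl | hn
    · rw [pow_zero]; exact norm_integer_le_one _
    · exact (integer_pow_dvd_iff hp0 n).1 (hx n hn)
  obtain ⟨L, hL⟩ := cauchySeq_tendsto_of_complete (cauchySeq_of_le_geometric _ _ hp1 h1)
  refine ⟨L, fun s hs => (integer_pow_dvd_iff hp0 s).2 ?_⟩
  have h2 : Tendsto (fun t => ‖x t - x s‖) atTop (𝓝 ‖L - x s‖) :=
    (hL.sub tendsto_const_nhds).norm
  refine le_of_tendsto h2 ?_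
  filter_upwards [eventually_ge_atTop s] with t ht
  exact (integer_pow_dvd_iff hp0 s).1 (pow_dvd_sub_of_le ht fun r hr _ => hx r (by omega))

theorem charP_residueField {p : ℕ} (hp : p.Prime) (hp1 : ‖(p : K)‖ < 1) :
    CharP (IsLocalRing.ResidueField (Integers K)) p := by
  have h : ((p : ℕ) : IsLocalRing.ResidueField (Integers K)) = 0 := by
    rw [← map_natCast (IsLocalRing.residue (Integers K)), IsLocalRing.residue_eq_zero_iff,
      IsLocalRing.mem_maximalIdeal, mem_nonunits_iff, isUnit_integer_iff]
    exact hp1.ne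
  exact (CharP.charP_iff_prime_eq_zero hp).2 h

/-! ### Analytic functions from power series with integral coefficients -/

/-- The ultrametric inequality bounds each homogeneous part by 1 however many monomials it has, so
the radius of convergence is at least 1. -/
theorem exists_formalMultilinearSeries {ι : Type*} [Fintype ι] [DecidableEq ι]
    (f : MvPowerSeries ι (Integers K)) :
    ∃ P : FormalMultilinearSeries K (ι → K) K, (∀ N, ‖P N‖ ≤ 1) ∧
      ∀ N (y : ι → K), (P N fun _ => y) = ∑ d ∈ (Finset.univ : Finset ι).finsuppAntidiag N,
        ((MvPowerSeries.coeff d f : Integers K) : K) * d.prod fun i e => y i ^ e := by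
  have hdeg : ∀ (N : ℕ) (d : ι →₀ ℕ), d ∈ (Finset.univ : Finset ι).finsuppAntidiag N →
      d.degree = N := by
    intro N d hd
    rw [Finset.mem_finsuppAntidiag] at hd
    rw [← hd.1, Finsupp.degree_eq_sum]
  have hW : ∀ (N : ℕ) (d : ι →₀ ℕ), ∃ W : ContinuousMultilinearMap K (fun _ : Fin N => ι → K) K,
      (∀ y, ‖W y‖ ≤ ∏ j, ‖y j‖) ∧ (d ∈ (Finset.univ : Finset ι).finsuppAntidiag N →
        ∀ y : ι → K, (W fun _ => y) = d.prod fun i e => y i ^ e) := by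
    intro N d
    by_cases hd : d ∈ (Finset.univ : Finset ι).finsuppAntidiag N
    · obtain ⟨w, hw⟩ := exists_word_prod_eq (K := K) d (hdeg N d hd)
      refine ⟨wordMap w, fun y => ?_, fun _ y => by rw [wordMap_apply, hw]⟩
      rw [wordMap_apply, norm_prod]
      exact Finset.prod_le_prod (fun j _ => norm_nonneg _) fun j _ => norm_le_pi_norm _ _
    · refine ⟨0, fun y => ?_, fun h => (hd h).elim⟩
      rw [zero_apply, norm_zero]
      exact Finset.prod_nonneg fun j _ => norm_nonneg _
  choose W hW1 hW2 using hW
  refine ⟨fun N => ∑ d ∈ (Finset.univ : Finset ι).finsuppAntidiag N,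
    ((MvPowerSeries.coeff d f : Integers K) : K) • W N d, fun N => ?_, fun N y => ?_⟩
  · refine ContinuousMultilinearMap.opNorm_le_bound zero_le_one fun y => ?_
    rw [one_mul, sum_apply]
    refine IsUltrametricDist.norm_sum_le_of_forall_le_of_nonneg
      (Finset.prod_nonneg fun j _ => norm_nonneg _) fun d _ => ?_
    rw [smul_apply, smul_eq_mul, norm_mul, ← one_mul (∏ j, ‖y j‖)]
    exact mul_le_mul (norm_integer_le_one _) (hW1 N d y) (norm_nonneg _) zero_le_one
  · rw [sum_apply]
    refine Finset.sum_congr rfl fun d hd => ?_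
    rw [smul_apply, smul_eq_mul, hW2 N d hd]

theorem hasEval_of_norm_lt_one {ι : Type*} [Finite ι] {x : ι → Integers K}
    (hx : ∀ i, ‖x i‖ < 1) : MvPowerSeries.HasEval x where
  hpow i := tendsto_pow_atTop_nhds_zero_of_norm_lt_one (hx i)
  tendsto_zero := by simp [cofinite_eq_bot]

/-- Grouping the convergent sum over monomials by total degree turns it into the sum of the
multilinear series. -/
theorem exists_hasFPowerSeriesOnBall [CompleteSpace K] {ι : Type*} [Fintype ι]
    (f : MvPowerSeries ι (Integers K)) {F : (ι → K) → K} {a : ι → K}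
    (hF : ∀ (x : ι → Integers K) (hx : ∀ i, ‖x i‖ < 1),
      F (fun i => a i + x i) = (MvPowerSeries.aeval (hasEval_of_norm_lt_one hx) f : Integers K)) :
    ∃ P : FormalMultilinearSeries K (ι → K) K, HasFPowerSeriesOnBall F P a 1 := by
  classical
  obtain ⟨P, hP1, hP⟩ := exists_formalMultilinearSeries f
  refine ⟨P, ?_, one_pos, fun {y} hy => ?_⟩
  · have := P.le_radius_of_bound 1 (r := 1) fun n => by simpa using hP1 n
    simpa using this
  · have hy1 : ‖y‖ < 1 := by
      rw [Metric.mem_eball, edist_zero_right, ← ofReal_norm, ENNReal.ofReal_lt_one] at hy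
      exact hy
    have hy2 : ∀ i, ‖y i‖ < 1 := fun i => (norm_le_pi_norm y i).trans_lt hy1
    let x : ι → Integers K := fun i => ⟨y i, mem_integers.2 (hy2 i).le⟩
    have hx : ∀ i, ‖x i‖ < 1 := hy2
    have h1 := MvPowerSeries.hasSum_aeval (R := Integers K) (hasEval_of_norm_lt_one hx) f
    have h2 := h1.map (Integers K).subtype continuous_subtype_val
    have h3 := h2.tsum_fiberwise (fun d : ι →₀ ℕ => d.degree)
    have h4 : F (a + y) = (Integers K).subtype
        (MvPowerSeries.aeval (hasEval_of_norm_lt_one hx) f) := hF x hx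
    rw [h4]
    convert h3 using 2 with N
    have h5 : (fun d : ι →₀ ℕ => d.degree) ⁻¹' {N} =
        ↑((Finset.univ : Finset ι).finsuppAntidiag N) := by
      ext d
      simp [Finset.mem_finsuppAntidiag, Finsupp.degree_eq_sum]
    rw [hP, h5, Finset.tsum_subtype']
    refine Finset.sum_congr rfl fun d _ => ?_
    simp [Finsupp.prod, x]

end Integers

/-! ### The limit over the ring of integers -/

theorem map_det_hasseWittEval {R S : Type*} [CommRing R] [CommRing S] (φ : R →+* S) (p q g s : ℕ)
    (z : Fin (g * q + 1) → R) :
    φ (hasseWittEval p q g s z).det = (hasseWittEval p q g s (fun i => φ (z i))).det := by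
  rw [RingHom.map_det, RingHom.mapMatrix_apply, map_hasseWittEval]

theorem map_rowMinor {R S : Type*} [CommRing R] [CommRing S] (φ : R →+* S) (q g : ℕ)
    (B : Matrix (Fin (g * q + 1)) (Fin g) R) :
    φ (rowMinor q g B) = rowMinor q g (B.map φ) := by
  rw [rowMinor, RingHom.map_det, RingHom.mapMatrix_apply, rowMinor, Matrix.submatrix_map]

section Limit

variable {K : Type*} [NontriviallyNormedField K] [IsUltrametricDist K]

theorem natCast_mem_nonZeroDivisors_integers {p : ℕ} (hp0 : (p : K) ≠ 0) :
    (p : Integers K) ∈ nonZeroDivisors (Integers K) :=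
  mem_nonZeroDivisors_of_ne_zero fun h => hp0 (congrArg Subtype.val h)

/-- Units of a local ring are detected in the residue field, which has characteristic p. -/
theorem isUnit_det_hasseWittEval_integers {p q g : ℕ} (hp : p.Prime) (hq : q.Prime)
    (hpe : g * q + 1 < p ^ ord p q) (hp1 : ‖(p : K)‖ < 1) {a : Fin (g * q + 1) → Integers K}
    (h : IsUnit (hasseWittEval p q g 1 a).det) {s : ℕ} (hs : 0 < s) :
    IsUnit (hasseWittEval p q g s a).det := by
  have := charP_residueField hp hp1
  rw [← IsLocalRing.residue_ne_zero_iff_isUnit, map_det_hasseWittEval, ← isUnit_iff_ne_zero] at h ⊢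
  exact isUnit_det_hasseWittEval_of_charP hp hq hpe h hs

theorem exists_limit_approxEval [CompleteSpace K] {p q g : ℕ} (hp : p.Prime) (hq : q.Prime)
    (hqp : q < p) (hpe : g * q + 1 < p ^ ord p q) (hp0 : (p : K) ≠ 0) (hp1 : ‖(p : K)‖ < 1)
    {a : Fin (g * q + 1) → Integers K} (h : IsUnit (hasseWittEval p q g 1 a).det) :
    ∃ T : Matrix (Fin (g * q + 1)) (Fin g) (Integers K), ∀ s, 0 < s → ∀ i l,
      (p : Integers K) ^ s ∣ T i l - approxEval p q g s a i l := by
  have h1 := fun i l => exists_integer_limit hp0 hp1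
    (x := fun s => approxEval p q g s a i l) fun s hs =>
      pow_dvd_approxEval_succ_sub hp hq hqp hpe (natCast_mem_nonZeroDivisors_integers hp0)
        (fun s hs => isUnit_det_hasseWittEval_integers hp hq hpe hp1 h hs) hs i l
  choose T hT using h1
  exact ⟨Matrix.of T, fun s hs i l => hT i l s hs⟩

theorem coeff_natCast_pow_mul {ι : Type*} {R : Type*} [CommRing R] (p s : ℕ) (d : ι →₀ ℕ)
    (f : MvPowerSeries ι R) :
    MvPowerSeries.coeff d ((p : MvPowerSeries ι R) ^ s * f) =
      (p : R) ^ s * MvPowerSeries.coeff d f := by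
  have : (p : MvPowerSeries ι R) ^ s = MvPowerSeries.C ((p : R) ^ s) := by simp
  rw [this, MvPowerSeries.coeff_C_mul]

theorem exists_series_limit [CompleteSpace K] {ι : Type*} {p : ℕ} (hp0 : (p : K) ≠ 0)
    (hp1 : ‖(p : K)‖ < 1) {x : ℕ → MvPowerSeries ι (Integers K)}
    (hx : ∀ s, 0 < s → (p : MvPowerSeries ι (Integers K)) ^ s ∣ x (s + 1) - x s) :
    ∃ L, ∀ s, 0 < s → (p : MvPowerSeries ι (Integers K)) ^ s ∣ L - x s := by
  have h1 := fun d : ι →₀ ℕ => exists_integer_limit hp0 hp1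
    (x := fun s => MvPowerSeries.coeff d (x s)) fun s hs => by
      obtain ⟨f, hf⟩ := hx s hs
      rw [← map_sub, hf, coeff_natCast_pow_mul]
      exact dvd_mul_right _ _
  choose L hL using h1
  let L' : MvPowerSeries ι (Integers K) := L
  refine ⟨L', fun s hs => ?_⟩
  choose c hc using fun d => hL d s hs
  let c' : MvPowerSeries ι (Integers K) := c
  refine ⟨c', ?_⟩
  ext d : 1
  rw [coeff_natCast_pow_mul, map_sub]
  exact hc d

theorem exists_hasFPowerSeriesOnBall_limit [CompleteSpace K] {p q g : ℕ} (hp : p.Prime)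
    (hq : q.Prime) (hqp : q < p) (hpe : g * q + 1 < p ^ ord p q) (hp0 : (p : K) ≠ 0)
    (hp1 : ‖(p : K)‖ < 1) (i : Fin (g * q + 1)) (l : Fin g) {F : (Fin (g * q + 1) → K) → K}
    (hF : ∀ a : Fin (g * q + 1) → Integers K, IsUnit (hasseWittEval p q g 1 a).det →
      ∀ s, 0 < s → ‖F (fun j => a j) - approxEval p q g s a i l‖ ≤ ‖(p : K)‖ ^ s)
    (a : Fin (g * q + 1) → Integers K) (ha : IsUnit (hasseWittEval p q g 1 a).det) :
    ∃ P : FormalMultilinearSeries K (Fin (g * q + 1) → K) K,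
      HasFPowerSeriesOnBall F P (fun j => a j) 1 := by
  -- The generic point near a. Its Hasse-Witt determinants are units since their constant
  -- coefficients are, so the Dwork congruence holds over O[[x]] and the limit J exists
  -- coefficientwise.
  let z : Fin (g * q + 1) → MvPowerSeries (Fin (g * q + 1)) (Integers K) :=
    fun j => MvPowerSeries.C (a j) + MvPowerSeries.X j
  have hz : ∀ s, 0 < s → IsUnit (hasseWittEval p q g s z).det := by
    intro s hs
    rw [MvPowerSeries.isUnit_iff_constantCoeff, map_det_hasseWittEval]
    simp only [z, map_add, MvPowerSeries.constantCoeff_C, MvPowerSeries.constantCoeff_X, add_zero]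
    exact isUnit_det_hasseWittEval_integers hp hq hpe hp1 ha hs
  have hreg : (p : MvPowerSeries (Fin (g * q + 1)) (Integers K)) ∈ nonZeroDivisors _ := by
    refine mem_nonZeroDivisors_of_ne_zero fun h => hp0 ?_
    have := congrArg MvPowerSeries.constantCoeff h
    rw [map_natCast, map_zero] at this
    exact congrArg Subtype.val this
  obtain ⟨J, hJ⟩ := exists_series_limit hp0 hp1 (x := fun s => approxEval p q g s z i l)
    fun s hs => pow_dvd_approxEval_succ_sub hp hq hqp hpe hreg hz hs i l
  refine exists_hasFPowerSeriesOnBall J fun x hx => ?_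
  let ev := (MvPowerSeries.aeval (R := Integers K) (hasEval_of_norm_lt_one hx)).toRingHom
  have hevz : (fun j => ev (z j)) = fun j => a j + x j := by
    funext j
    have h1 := MvPowerSeries.aeval_coe (R := Integers K) (hasEval_of_norm_lt_one hx)
      (MvPolynomial.C (a j) + MvPolynomial.X j)
    simpa [ev, z] using h1
  have hunit : IsUnit (hasseWittEval p q g 1 fun j => a j + x j).det := by
    rw [← hevz, ← map_det_hasseWittEval]
    exact (hz 1 one_pos).map ev
  have hmap : ∀ s, 0 < s → ev (approxEval p q g s z i l) =
      approxEval p q g s (fun j => a j + x j) i l := by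
    intro s hs
    rw [← hevz, ← map_approxEval ev (hz s hs), Matrix.map_apply]
  change F (fun j => ((a j + x j : Integers K) : K)) = (ev J : Integers K)
  -- Both F and the value of J are within ‖p‖^s of the same approximant, because evaluation at x
  -- sends the generic point to a + x.
  have h2 : ∀ s, 0 < s → ‖F (fun j => ((a j + x j : Integers K) : K)) - (ev J : Integers K)‖ ≤
      ‖(p : K)‖ ^ s := by
    intro s hs
    have h3 := hF _ hunit s hs
    have h4 : (p : Integers K) ^ s ∣ ev J - approxEval p q g s (fun j => a j + x j) i l := by
      rw [← hmap s hs, ← map_sub]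
      simpa using map_dvd ev (hJ s hs)
    rw [integer_pow_dvd_iff hp0] at h4
    rw [← sub_sub_sub_cancel_right _ _
      ((approxEval p q g s (fun j => a j + x j) i l : Integers K) : K)]
    rw [sub_eq_add_neg]
    refine (IsUltrametricDist.norm_add_le_max _ _).trans (max_le h3 ?_)
    rw [norm_neg]
    exact h4
  rw [← sub_eq_zero, ← norm_le_zero_iff]
  refine ge_of_tendsto (tendsto_pow_atTop_nhds_zero_of_lt_one (norm_nonneg _) hp1) ?_
  filter_upwards [eventually_gt_atTop 0] with s hs using h2 s hs

theorem integer_eq_zero_of_forall_pow_dvd {p : ℕ} (hp0 : (p : K) ≠ 0) (hp1 : ‖(p : K)‖ < 1)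
    {x : Integers K} (h : ∀ s, 0 < s → (p : Integers K) ^ s ∣ x) : x = 0 := by
  rw [← norm_le_zero_iff]
  refine ge_of_tendsto (tendsto_pow_atTop_nhds_zero_of_lt_one (norm_nonneg _) hp1) ?_
  filter_upwards [eventually_gt_atTop 0] with s hs
  exact (integer_pow_dvd_iff hp0 s).1 (h s hs)

/-! ### Linear relations and the minor of the limit matrix. -/

section Relations

variable {p q g : ℕ} {a : Fin (g * q + 1) → Integers K}
  {T : Matrix (Fin (g * q + 1)) (Fin g) (Integers K)}

theorem sum_limit_eq_zero (hp : p.Prime) (hq : q.Prime) (hqp : q < p)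
    (hp0 : (p : K) ≠ 0) (hp1 : ‖(p : K)‖ < 1)
    (hT : ∀ s, 0 < s → ∀ i l, (p : Integers K) ^ s ∣ T i l - approxEval p q g s a i l)
    (l : Fin g) : ∑ i, T i l = 0 := by
  refine integer_eq_zero_of_forall_pow_dvd hp0 hp1 fun s hs => ?_
  have h1 : (p : Integers K) ^ s ∣ ∑ i, approxEval p q g s a i l := by
    simp only [approxEval, Matrix.mul_apply]
    rw [Finset.sum_comm]
    refine Finset.dvd_sum fun k _ => ?_
    rw [← Finset.sum_mul]
    refine Dvd.dvd.mul_right (dvd_trans ?_ (dvd_sum_solEval hp hq hqp hs a k)) _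
    rw [← pow_mul, Nat.cast_pow]
    exact pow_dvd_pow _ (Nat.le_mul_of_pos_left _ (ord_pos hp hq hqp))
  have h2 : (p : Integers K) ^ s ∣ ∑ i, (T i l - approxEval p q g s a i l) :=
    Finset.dvd_sum fun i _ => hT s hs i l
  rw [Finset.sum_sub_distrib] at h2
  exact (dvd_sub_left h1).1 h2

/-- Multiplying the relation modulo Q^s by A_s⁻¹ and letting s grow makes it exact. -/
theorem powerMatrix_mul_limit (hp : p.Prime) (hq : q.Prime) (hqp : q < p)
    (hpe : g * q + 1 < p ^ ord p q) (hp0 : (p : K) ≠ 0) (hp1 : ‖(p : K)‖ < 1)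
    (h : IsUnit (hasseWittEval p q g 1 a).det)
    (hT : ∀ s, 0 < s → ∀ i l, (p : Integers K) ^ s ∣ T i l - approxEval p q g s a i l) :
    powerMatrix q g a * T = powerSumMatrix q g a := by
  ext u l : 1
  rw [eq_comm, ← sub_eq_zero]
  refine integer_eq_zero_of_forall_pow_dvd hp0 hp1 fun s hs => ?_
  have hu := isUnit_det_hasseWittEval_integers hp hq hpe hp1 h hs
  have h1 : (powerSumMatrix q g a * hasseWittEval p q g s a -
      powerMatrix q g a * solEval p q g s a) * (hasseWittEval p q g s a)⁻¹ =
      powerSumMatrix q g a - powerMatrix q g a * approxEval p q g s a := by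
    rw [Matrix.sub_mul, Matrix.mul_assoc, Matrix.mul_nonsing_inv _ hu, Matrix.mul_one,
      Matrix.mul_assoc, approxEval]
  have h2 : (p : Integers K) ^ s ∣ (powerSumMatrix q g a -
      powerMatrix q g a * approxEval p q g s a) u l := by
    rw [← h1, Matrix.mul_apply]
    refine Finset.dvd_sum fun k _ => Dvd.dvd.mul_right
      (dvd_trans ?_ (dvd_powerSumMatrix_mul_sub hp hq hqp hpe hs a u k)) _
    rw [← pow_mul, Nat.cast_pow]
    exact pow_dvd_pow _ (Nat.le_mul_of_pos_left _ (ord_pos hp hq hqp))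
  have h3 : (p : Integers K) ^ s ∣ (powerMatrix q g a * (T - approxEval p q g s a)) u l := by
    rw [Matrix.mul_apply]
    exact Finset.dvd_sum fun k _ => Dvd.dvd.mul_left (hT s hs k l) _
  have h4 := dvd_sub h2 h3
  rw [Matrix.mul_sub] at h4
  simpa using h4

/-- By `powerMatrix_mul_limit` the limit matrix has a left multiple that is invertible in
characteristic zero. -/
theorem linearIndependent_col_limit (hp : p.Prime) (hq : q.Prime) (hqp : q < p)
    (hpe : g * q + 1 < p ^ ord p q) (hp0 : (p : K) ≠ 0) (hp1 : ‖(p : K)‖ < 1) [CharZero K]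
    (h : IsUnit (hasseWittEval p q g 1 a).det)
    (hT : ∀ s, 0 < s → ∀ i l, (p : Integers K) ^ s ∣ T i l - approxEval p q g s a i l) :
    LinearIndependent K (T.map (Integers K).subtype).col := by
  have h1 := congrArg (fun M => M.map (Integers K).subtype)
    (powerMatrix_mul_limit hp hq hqp hpe hp0 hp1 h hT)
  simp only [Matrix.map_mul] at h1
  have hdet : ((powerSumMatrix q g a).map (Integers K).subtype).det ≠ 0 := by
    rw [← RingHom.mapMatrix_apply, ← RingHom.map_det, det_powerSumMatrix, map_prod]
    refine Finset.prod_ne_zero_iff.2 fun u _ => ?_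
    rw [map_neg, map_natCast, neg_ne_zero, Nat.cast_ne_zero]
    exact Nat.succ_ne_zero _
  rw [← h1] at hdet
  rw [← Matrix.mulVec_injective_iff]
  intro x y hxy
  have h2 := congrArg (fun v => Matrix.mulVec ((powerMatrix q g a).map (Integers K).subtype) v) hxy
  simp only [Matrix.mulVec_mulVec] at h2
  exact Matrix.mulVec_injective_of_isUnit ((Matrix.isUnit_iff_isUnit_det _).2 hdet.isUnit) h2

theorem natCast_dvd_rowMinor_limit_sub
    (hT : ∀ s, 0 < s → ∀ i l, (p : Integers K) ^ s ∣ T i l - approxEval p q g s a i l) :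
    (p : Integers K) ∣ rowMinor q g T - rowMinor q g (approxEval p q g 1 a) := by
  rw [← Ideal.mem_span_singleton, ← Ideal.Quotient.eq, map_rowMinor, map_rowMinor]
  congr 1
  ext i l
  rw [Matrix.map_apply, Matrix.map_apply, Ideal.Quotient.eq, Ideal.mem_span_singleton]
  simpa using hT 1 one_pos i l

end Relations

end Limit

/-! ### Points with nonvanishing reductions -/

/-- If ζ^l ≠ 1 became 1 under φ, the vanishing geometric sum of ζ^l over N terms would be sent to N
≠ 0. -/
theorem isPrimitiveRoot_map {R k : Type*} [CommRing R] [IsDomain R] [CommRing k] {N : ℕ}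
    (φ : R →+* k) (hN : (N : k) ≠ 0) {ζ : R} (hζ : IsPrimitiveRoot ζ N) :
    IsPrimitiveRoot (φ ζ) N := by
  refine ⟨by rw [← map_pow, hζ.pow_eq_one, map_one], fun l hl => hζ.dvd_of_pow_eq_one _ ?_⟩
  by_contra hne
  refine hN ?_
  have h1 : (∑ i ∈ Finset.range N, (ζ ^ l) ^ i) * (ζ ^ l - 1) = 0 := by
    rw [geom_sum_mul, ← pow_mul, mul_comm, pow_mul, hζ.pow_eq_one, one_pow, sub_self]
  have h2 := (mul_eq_zero.1 h1).resolve_right (sub_ne_zero.2 hne)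
  have h3 := congrArg φ h2
  simpa only [map_sum, map_pow, hl, one_pow, Finset.sum_const, Finset.card_range, nsmul_eq_mul,
    mul_one, map_zero] using h3

theorem exists_finset_card_eq {k : Type*} [Field k] {N : ℕ} (hN : 0 < N) {ζ : k}
    (hζ : IsPrimitiveRoot ζ N) : ∃ S : Finset k, S.card = N + 1 := by
  classical
  refine ⟨insert 0 (Polynomial.nthRootsFinset N 1), ?_⟩
  rw [Finset.card_insert_of_notMem, hζ.card_nthRootsFinset]
  rw [Polynomial.mem_nthRootsFinset hN]
  simp [hN.ne']

theorem evalInt_eq_eval₂_map {k A ι : Type*} [CommRing k] [CommRing A] (ψ : k →+* A) (y : ι → A)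
    (P : MvPolynomial ι ℤ) :
    evalInt y P = MvPolynomial.eval₂ ψ y (MvPolynomial.map (Int.castRingHom k) P) := by
  rw [MvPolynomial.eval₂_map, evalInt, MvPolynomial.coe_eval₂Hom,
    RingHom.eq_intCast' (ψ.comp (Int.castRingHom k))]

/-- A polynomial whose degree in each variable is below |S| and which vanishes on S^n is zero over
k, hence also over L. -/
theorem exists_evalInt_ne_zero {k L : Type*} [Field k] [Field L] (φ : k →+* L) {n : ℕ}
    {P : MvPolynomial (Fin n) ℤ} {S : Finset k} (hS : P.totalDegree < S.card)
    (hP : ∃ z : Fin n → L, evalInt z P ≠ 0) : ∃ b : Fin n → k, evalInt b P ≠ 0 := by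
  by_contra! hcon
  obtain ⟨z, hz⟩ := hP
  have h0 : MvPolynomial.map (Int.castRingHom k) P = 0 := by
    refine MvPolynomial.eq_zero_of_eval_zero_at_prod_finset _ (fun _ => S) (fun i => ?_) fun x _ => ?_
    · exact (MvPolynomial.degreeOf_le_totalDegree _ _).trans_lt
        ((Finset.sup_mono (MvPolynomial.support_map_subset _ _)).trans_lt hS)
    · have := evalInt_eq_eval₂_map (RingHom.id k) x P
      rw [hcon x] at this
      exact this.symm
  rw [evalInt_eq_eval₂_map φ z, h0, MvPolynomial.eval₂_zero] at hz
  exact hz rfl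

theorem evalInt_det_mul_rowMinor {R : Type*} [CommRing R] (p q g s : ℕ)
    (z : Fin (g * q + 1) → R) :
    evalInt z ((hasseWitt p q g s).det * rowMinor q g (solMatrix p q g s)) =
      (hasseWittEval p q g s z).det * rowMinor q g (solEval p q g s z) := by
  rw [map_mul, map_rowMinor, RingHom.map_det]
  rfl

theorem rowMinor_mul {R : Type*} [CommRing R] {q g : ℕ} (B : Matrix (Fin (g * q + 1)) (Fin g) R)
    (A : Matrix (Fin g) (Fin g) R) : rowMinor q g (B * A) = rowMinor q g B * A.det := by
  rw [rowMinor, rowMinor, ← Matrix.det_mul]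
  rfl

theorem exists_integers_isUnit {K : Type*} [NontriviallyNormedField K] [IsUltrametricDist K]
    [CharZero K] {p q g N : ℕ} (hp : p.Prime) (hq : q.Prime) (hqp : q < p) (hg : 0 < g)
    (hpe : g * q + 1 < p ^ ord p q) (hpn : (g * q + 1) + q ≤ p + 2) (hp1 : ‖(p : K)‖ < 1)
    {ζ : Integers K} (hζ : IsPrimitiveRoot ζ N) (hN : ¬ p ∣ N)
    (hdeg : degPhi p q g + degM p q g < N + 1) :
    ∃ a : Fin (g * q + 1) → Integers K, (∀ i j, i ≠ j → a i ≠ a j) ∧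
      IsUnit (hasseWittEval p q g 1 a).det ∧ IsUnit (rowMinor q g (solEval p q g 1 a)) := by
  have := charP_residueField hp hp1
  set k := IsLocalRing.ResidueField (Integers K)
  set ρ := IsLocalRing.residue (Integers K) with hρ
  have hNk : (N : k) ≠ 0 := by rwa [Ne, CharP.cast_eq_zero_iff k p]
  have hN0 : 0 < N := Nat.pos_of_ne_zero fun h => hN (h ▸ dvd_zero p)
  obtain ⟨S, hS⟩ := exists_finset_card_eq hN0 (isPrimitiveRoot_map ρ hNk hζ)
  have : CharP (AlgebraicClosure k) p := charP_of_injective_algebraMap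
    (algebraMap k (AlgebraicClosure k)).injective p
  obtain ⟨z, hz1, hz2⟩ := exists_det_ne_zero_and_rowMinor_ne_zero (AlgebraicClosure k) hp hq hqp hg
    hpe hpn
  obtain ⟨b, hb⟩ := exists_evalInt_ne_zero (algebraMap k (AlgebraicClosure k))
    (P := (hasseWitt p q g 1).det * rowMinor q g (solMatrix p q g 1)) (S := S)
    (by rw [hS]; exact (MvPolynomial.totalDegree_mul _ _).trans_lt hdeg)
    ⟨z, by rw [evalInt_det_mul_rowMinor]; exact mul_ne_zero hz1 hz2⟩
  obtain ⟨r, hr⟩ := (IsLocalRing.residue_surjective (R := Integers K)).hasRightInverse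
  -- Adding p · i does not change residues and separates coordinates whose chosen lifts coincide.
  let a : Fin (g * q + 1) → Integers K := fun i => r (b i) + (p : Integers K) * (i : ℕ)
  have ha : (fun i => ρ (a i)) = b := by
    funext i
    have : ρ (r (b i)) = b i := hr (b i)
    simp [a, this]
  have hchar : CharZero (Integers K) :=
    ⟨fun m n h => Nat.cast_injective (R := K) (congrArg Subtype.val h)⟩
  refine ⟨a, fun i j hij h => hij ?_, ?_⟩
  · have h1 : b i = b j := by
      rw [← ha]
      exact congrArg ρ h
    simp only [a, h1, add_right_inj] at h
    exact Fin.ext (Nat.cast_injective (mul_left_cancel₀ (Nat.cast_ne_zero.2 hp.ne_zero) h))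
  · rw [← IsUnit.mul_iff, ← evalInt_det_mul_rowMinor, ← IsLocalRing.residue_ne_zero_iff_isUnit,
      map_evalInt]
    change evalInt (fun i => ρ (a i)) _ ≠ 0
    rw [ha]
    exact hb

/-! ### The unramified field -/

section Unramified

variable {p q g m : ℕ} [Fact p.Prime]

theorem finiteDimensional_unr (hm : 0 < m) (hp2 : 2 < p) :
    FiniteDimensional ℚ_[p] (Unr p m) := by
  have hN : 0 < p ^ m - 1 := Nat.sub_pos_of_lt (Nat.one_lt_pow hm.ne' (by omega))
  have : Finite {ζ : PadicAlgCl p | IsPrimitiveRoot ζ (p ^ m - 1)} := by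
    refine Set.Finite.subset (Polynomial.nthRootsFinset (p ^ m - 1) (1 : PadicAlgCl p)).finite_toSet
      fun ζ hζ => ?_
    rw [Finset.mem_coe, Polynomial.mem_nthRootsFinset hN]
    exact hζ.pow_eq_one
  exact IntermediateField.finiteDimensional_adjoin fun x _ => Algebra.IsIntegral.isIntegral x

theorem completeSpace_unr (hm : 0 < m) (hp2 : 2 < p) : CompleteSpace (Unr p m) := by
  have := finiteDimensional_unr hm hp2
  exact FiniteDimensional.complete ℚ_[p] (Unr p m)

theorem norm_natCast_unr : ‖(p : Unr p m)‖ = (p : ℝ)⁻¹ := by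
  have h : ‖algebraMap ℚ_[p] (Unr p m) p‖ = ‖(p : ℚ_[p])‖ := PadicAlgCl.norm_extends p p
  rw [map_natCast, Padic.norm_p] at h
  exact h

theorem exists_isPrimitiveRoot_integers (hm : 0 < m) (hp2 : 2 < p) :
    ∃ ζ : Integers (Unr p m), IsPrimitiveRoot ζ (p ^ m - 1) := by
  have hN : p ^ m - 1 ≠ 0 := (Nat.sub_pos_of_lt (Nat.one_lt_pow hm.ne' (by omega))).ne'
  have : NeZero (p ^ m - 1) := ⟨hN⟩
  obtain ⟨ζ, hζ⟩ := HasEnoughRootsOfUnity.exists_primitiveRoot (PadicAlgCl p) (p ^ m - 1)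
  have hmem : ζ ∈ unramifiedField p m := IntermediateField.subset_adjoin _ _ hζ
  have h1 : IsPrimitiveRoot (⟨ζ, hmem⟩ : Unr p m) (p ^ m - 1) :=
    IsPrimitiveRoot.of_map_of_injective (f := (unramifiedField p m).val) hζ Subtype.val_injective
  have h2 : ‖(⟨ζ, hmem⟩ : Unr p m)‖ = 1 := by
    rw [← pow_eq_one_iff_of_nonneg (norm_nonneg _) hN, ← norm_pow, h1.pow_eq_one, norm_one]
  refine ⟨⟨⟨ζ, hmem⟩, mem_integers.2 h2.le⟩, ?_⟩
  exact IsPrimitiveRoot.of_map_of_injective (f := (Integers (Unr p m)).subtype) h1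
    Subtype.val_injective

theorem hasseWittAt_eq (s : ℕ) (a : Space p q g m) :
    hasseWittAt p q g m s a = hasseWittEval p q g s a := by
  exact Matrix.ext fun u v => aeval_eq_evalInt a _

theorem solMatrixAt_eq (s : ℕ) (a : Space p q g m) :
    solMatrixAt p q g m s a = solEval p q g s a := by
  exact Matrix.ext fun u v => aeval_eq_evalInt a _

theorem approxMatrix_eq (s : ℕ) (a : Space p q g m) :
    approxMatrix p q g m s a = approxEval p q g s a := by
  rw [approxMatrix, hasseWittAt_eq, solMatrixAt_eq, approxEval]

/-- Norm one means unit in the ring of integers, which allows everything to be done over that ring.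
-/
theorem mem_domain_iff {a : Space p q g m} : a ∈ domain p q g m ↔
    ∃ b : Fin (g * q + 1) → Integers (Unr p m), (fun i => (b i : Unr p m)) = a ∧
      IsUnit (hasseWittEval p q g 1 b).det := by
  have key : ∀ b : Fin (g * q + 1) → Integers (Unr p m),
      (hasseWittAt p q g m 1 fun i => (b i : Unr p m)).det =
        ((hasseWittEval p q g 1 b).det : Integers (Unr p m)) := fun b => by
    rw [hasseWittAt_eq]
    exact (map_det_hasseWittEval (Integers (Unr p m)).subtype p q g 1 b).symm
  constructor
  · rintro ⟨h1, h2⟩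
    refine ⟨fun i => ⟨a i, mem_integers.2 (h1 i)⟩, rfl, ?_⟩
    rw [isUnit_integer_iff, ← key]
    exact h2
  · rintro ⟨b, rfl, hb⟩
    refine ⟨fun i => norm_integer_le_one (b i), ?_⟩
    rw [key, ← isUnit_integer_iff]
    exact hb

theorem limitMatrix_spec (hq : q.Prime) (hqp : q < p)
    (hpe : g * q + 1 < p ^ ord p q) (hm : 0 < m) {b : Fin (g * q + 1) → Integers (Unr p m)}
    (hb : IsUnit (hasseWittEval p q g 1 b).det) :
    ∃ T : Matrix (Fin (g * q + 1)) (Fin g) (Integers (Unr p m)),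
      (∀ s, 0 < s → ∀ i l, (p : Integers (Unr p m)) ^ s ∣ T i l - approxEval p q g s b i l) ∧
      limitMatrix p q g m (fun i => b i) = T.map (Integers (Unr p m)).subtype := by
  have hp : p.Prime := Fact.out
  have hp2 : 2 < p := hq.two_le.trans_lt hqp
  have := completeSpace_unr hm hp2
  have hp0 : (p : Unr p m) ≠ 0 := Nat.cast_ne_zero.2 hp.ne_zero
  have hp1 : ‖(p : Unr p m)‖ < 1 := by
    rw [norm_natCast_unr]
    exact inv_lt_one_of_one_lt₀ (by exact_mod_cast hp.one_lt)
  obtain ⟨T, hT⟩ := exists_limit_approxEval hp hq hqp hpe hp0 hp1 hb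
  refine ⟨T, hT, ?_⟩
  ext i l : 1
  rw [limitMatrix, Matrix.of_apply, Matrix.map_apply]
  refine Tendsto.limUnder_eq ?_
  rw [tendsto_iff_norm_sub_tendsto_zero]
  refine squeeze_zero' (Eventually.of_forall fun _ => norm_nonneg _) ?_
    (tendsto_pow_atTop_nhds_zero_of_lt_one (norm_nonneg _) hp1)
  filter_upwards [eventually_gt_atTop 0] with s hs
  have h1 := (integer_pow_dvd_iff hp0 s).1 (hT s hs i l)
  have h2 := map_approxEval (Integers (Unr p m)).subtype
    (isUnit_det_hasseWittEval_integers hp hq hpe hp1 hb hs)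
  rw [norm_sub_rev, approxMatrix_eq]
  have h3 : approxEval p q g s (fun i => (b i : Unr p m)) i l =
      (approxEval p q g s b i l : Integers (Unr p m)) := by
    exact (congrFun (congrFun h2 i) l).symm
  rw [h3]
  exact h1

theorem norm_limitMatrix_sub_le (hq : q.Prime) (hqp : q < p)
    (hpe : g * q + 1 < p ^ ord p q) (hm : 0 < m) {b : Fin (g * q + 1) → Integers (Unr p m)}
    (hb : IsUnit (hasseWittEval p q g 1 b).det) {s : ℕ} (hs : 0 < s) (i : Fin (g * q + 1))
    (l : Fin g) :
    ‖limitMatrix p q g m (fun i => b i) i l - (approxEval p q g s b i l : Integers (Unr p m))‖ ≤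
      ‖(p : Unr p m)‖ ^ s := by
  obtain ⟨T, hT, hlim⟩ := limitMatrix_spec hq hqp hpe hm hb
  rw [hlim]
  exact (integer_pow_dvd_iff (Nat.cast_ne_zero.2 (Fact.out : p.Prime).ne_zero) s).1 (hT s hs i l)

end Unramified

/-! ### The assertions over the unramified field. -/

section Main

variable {p q g m : ℕ} [Fact p.Prime]

theorem norm_natCast_unr_lt_one : ‖(p : Unr p m)‖ < 1 := by
  rw [norm_natCast_unr]
  exact inv_lt_one_of_one_lt₀ (by exact_mod_cast (Fact.out : p.Prime).one_lt)

theorem natCast_unr_ne_zero : (p : Unr p m) ≠ 0 :=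
  Nat.cast_ne_zero.2 (Fact.out : p.Prime).ne_zero

theorem approxMatrix_integers (hq : q.Prime) (hpe : g * q + 1 < p ^ ord p q)
    {b : Fin (g * q + 1) → Integers (Unr p m)} (hb : IsUnit (hasseWittEval p q g 1 b).det)
    {s : ℕ} (hs : 0 < s) :
    approxMatrix p q g m s (fun i => b i) =
      (approxEval p q g s b).map (Integers (Unr p m)).subtype := by
  rw [approxMatrix_eq, map_approxEval (Integers (Unr p m)).subtype
    (isUnit_det_hasseWittEval_integers Fact.out hq hpe norm_natCast_unr_lt_one hb hs)]
  rfl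

theorem tendstoUniformlyOn_approxMatrix (hq : q.Prime) (hqp : q < p)
    (hpe : g * q + 1 < p ^ ord p q) (hm : 0 < m) (i : Fin (g * q + 1)) (l : Fin g) :
    TendstoUniformlyOn (fun (s : ℕ) a => approxMatrix p q g m s a i l)
      (fun a => limitMatrix p q g m a i l) atTop (domain p q g m) := by
  rw [Metric.tendstoUniformlyOn_iff]
  intro ε hε
  have h := (tendsto_pow_atTop_nhds_zero_of_lt_one (norm_nonneg (p : Unr p m))
    norm_natCast_unr_lt_one).eventually (gt_mem_nhds hε)
  filter_upwards [h, eventually_gt_atTop 0] with s hsε hs a ha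
  obtain ⟨b, rfl, hb⟩ := mem_domain_iff.1 ha
  rw [dist_eq_norm, approxMatrix_integers hq hpe hb hs]
  exact (norm_limitMatrix_sub_le hq hqp hpe hm hb hs i l).trans_lt hsε

theorem analyticOnPolydiscs_limitMatrix (hq : q.Prime) (hqp : q < p)
    (hpe : g * q + 1 < p ^ ord p q) (hm : 0 < m) (i : Fin (g * q + 1)) (l : Fin g) :
    AnalyticOnPolydiscs (K := Unr p m) (fun a => limitMatrix p q g m a i l) (domain p q g m) := by
  intro a ha
  obtain ⟨b, rfl, hb⟩ := mem_domain_iff.1 ha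
  have := completeSpace_unr hm (hq.two_le.trans_lt hqp)
  exact exists_hasFPowerSeriesOnBall_limit Fact.out hq hqp hpe natCast_unr_ne_zero
    norm_natCast_unr_lt_one i l (F := fun a => limitMatrix p q g m a i l)
    (fun c hc s hs => norm_limitMatrix_sub_le hq hqp hpe hm hc hs i l) b hb

theorem linearIndependent_col_limitMatrix (hq : q.Prime) (hqp : q < p)
    (hpe : g * q + 1 < p ^ ord p q) (hm : 0 < m) {a : Space p q g m} (ha : a ∈ domain p q g m) :
    LinearIndependent (Unr p m) (limitMatrix p q g m a).col := by
  obtain ⟨b, rfl, hb⟩ := mem_domain_iff.1 ha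
  obtain ⟨T, hT, hlim⟩ := limitMatrix_spec hq hqp hpe hm hb
  rw [hlim]
  exact linearIndependent_col_limit Fact.out hq hqp hpe natCast_unr_ne_zero
    norm_natCast_unr_lt_one hb hT

theorem isAnalyticBundle_distribution (hq : q.Prime) (hqp : q < p)
    (hpe : g * q + 1 < p ^ ord p q) (hm : 0 < m) :
    IsAnalyticBundle (zeroSum p q g m) (domainO p q g m) (distribution p q g m) g where
  le := by
    rintro a ⟨ha, -⟩
    obtain ⟨b, rfl, hb⟩ := mem_domain_iff.1 ha
    obtain ⟨T, hT, hlim⟩ := limitMatrix_spec hq hqp hpe hm hb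
    rw [distribution, Submodule.span_le]
    rintro _ ⟨l, rfl⟩
    change ∑ i, limitMatrix p q g m (fun i => b i) i l = 0
    have h := congrArg (Integers (Unr p m)).subtype (sum_limit_eq_zero Fact.out hq hqp
      natCast_unr_ne_zero norm_natCast_unr_lt_one hT l)
    rw [map_sum, map_zero] at h
    rw [hlim]
    exact h
  rank := by
    rintro a ⟨ha, -⟩
    rw [distribution]
    have h := finrank_span_eq_card (linearIndependent_col_limitMatrix hq hqp hpe hm ha)
    rwa [Fintype.card_fin] at h
  frame := by
    rintro a ⟨ha, -⟩
    have := completeSpace_unr hm (hq.two_le.trans_lt hqp)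
    -- The columns of the limit matrix themselves are the frame; the expansions at a converge on
    -- this whole ball.
    refine ⟨Metric.eball a 1, Metric.isOpen_eball, Metric.mem_eball_self one_pos,
      fun l b => (limitMatrix p q g m b).col l, fun l => ?_, fun b hb => ⟨?_, rfl⟩⟩
    · intro b hb
      refine AnalyticAt.pi fun i => ?_
      obtain ⟨P, hP⟩ := analyticOnPolydiscs_limitMatrix hq hqp hpe hm i l a ha
      exact hP.analyticOnNhd b hb
    · exact linearIndependent_col_limitMatrix hq hqp hpe hm hb.2.1

theorem norm_rowMinor_limitMatrix_sub_le (hq : q.Prime) (hqp : q < p)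
    (hpe : g * q + 1 < p ^ ord p q) (hm : 0 < m) {a : Space p q g m} (ha : a ∈ domain p q g m) :
    ‖rowMinor q g (limitMatrix p q g m a) - rowMinor q g (approxMatrix p q g m 1 a)‖ ≤
      (p : ℝ)⁻¹ := by
  obtain ⟨b, rfl, hb⟩ := mem_domain_iff.1 ha
  obtain ⟨T, hT, hlim⟩ := limitMatrix_spec hq hqp hpe hm hb
  have h1 : rowMinor q g (limitMatrix p q g m fun i => b i) -
      rowMinor q g (approxMatrix p q g m 1 fun i => b i) =
      ((rowMinor q g T - rowMinor q g (approxEval p q g 1 b) : Integers (Unr p m)) : Unr p m) := by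
    rw [hlim, approxMatrix_integers hq hpe hb one_pos, ← map_rowMinor, ← map_rowMinor]
    rfl
  have h2 : (p : Integers (Unr p m)) ^ 1 ∣
      rowMinor q g T - rowMinor q g (approxEval p q g 1 b) := by
    rw [pow_one]
    exact natCast_dvd_rowMinor_limit_sub hT
  have h3 := (integer_pow_dvd_iff natCast_unr_ne_zero 1).1 h2
  rw [pow_one, norm_natCast_unr] at h3
  rw [h1]
  exact h3

theorem exists_norm_rowMinor_limitMatrix_eq_one (hq : q.Prime) (hqp : q < p) (hg : 0 < g)
    (hpe : g * q + 1 < p ^ ord p q) (hp : (g * q + 1) + q ≤ p + 2) (hm : 0 < m)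
    (hdeg : degPhi p q g + degM p q g < p ^ m) :
    ∃ a ∈ domainO p q g m, ‖rowMinor q g (limitMatrix p q g m a)‖ = 1 := by
  have hpp : p.Prime := Fact.out
  obtain ⟨ζ, hζ⟩ := exists_isPrimitiveRoot_integers (p := p) hm (hq.two_le.trans_lt hqp)
  have hpow : p ^ m - 1 + 1 = p ^ m := Nat.sub_add_cancel (Nat.one_le_pow _ _ hpp.pos)
  have hN : ¬ p ∣ p ^ m - 1 := by
    intro h
    have h1 := (Nat.dvd_add_right h).1 (hpow ▸ dvd_pow_self p hm.ne')
    exact hpp.one_lt.ne' (Nat.dvd_one.1 h1)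
  obtain ⟨b, hinj, hdet, hminor⟩ := exists_integers_isUnit hpp hq hqp hg hpe hp
    norm_natCast_unr_lt_one hζ hN (by rwa [hpow])
  obtain ⟨T, hT, hlim⟩ := limitMatrix_spec hq hqp hpe hm hdet
  refine ⟨fun i => b i, ⟨mem_domain_iff.2 ⟨b, rfl, hdet⟩,
    fun i j hij h => hinj i j hij (Subtype.ext h)⟩, ?_⟩
  rw [hlim, ← map_rowMinor]
  refine isUnit_integer_iff.1 ?_
  have h1 : IsUnit (rowMinor q g (approxEval p q g 1 b)) := by
    rw [approxEval, rowMinor_mul]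
    exact hminor.mul ((Matrix.isUnit_nonsing_inv_det_iff).2 hdet)
  have := charP_residueField (K := Unr p m) hpp norm_natCast_unr_lt_one
  rw [← IsLocalRing.residue_ne_zero_iff_isUnit] at h1 ⊢
  obtain ⟨c, hc⟩ := natCast_dvd_rowMinor_limit_sub hT
  -- The limit minor and the minor of I_1 A_1⁻¹ have the same residue, so one is a unit when the
  -- other is.
  rw [sub_eq_iff_eq_add.1 hc, map_add, map_mul, map_natCast, CharP.cast_eq_zero, zero_mul, zero_add]
  exact h1

end Main

end PadicKZ

end

theorem mainTheorem1 (p q g m : ℕ) [Fact p.Prime] (hq : q.Prime) (hqp : q < p) (hg : 0 < g)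
    (hpe : g * q + 1 < p ^ PadicKZ.ord p q) (hp : (g * q + 1) + q ≤ p + 2) (hm : 0 < m)
    (hdeg : PadicKZ.degPhi p q g + PadicKZ.degM p q g < p ^ m) :
    -- the limit matrix exists, uniformly on the domain, and is analytic there
    (∀ i l, TendstoUniformlyOn (fun (s : ℕ) a => PadicKZ.approxMatrix p q g m s a i l)
      (fun a => PadicKZ.limitMatrix p q g m a i l) Filter.atTop (PadicKZ.domain p q g m)) ∧
    (∀ i l, PadicKZ.AnalyticOnPolydiscs (K := PadicKZ.Unr p m)
      (fun a => PadicKZ.limitMatrix p q g m a i l) (PadicKZ.domain p q g m)) ∧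
    -- the spans of its columns form an analytic vector bundle of rank `g`
    PadicKZ.IsAnalyticBundle (PadicKZ.zeroSum p q g m) (PadicKZ.domainO p q g m)
      (PadicKZ.distribution p q g m) g ∧
    -- the distinguished minor of the limit matrix modulo `p`
    (∀ a ∈ PadicKZ.domain p q g m,
      ‖PadicKZ.rowMinor q g (PadicKZ.limitMatrix p q g m a) -
        PadicKZ.rowMinor q g (PadicKZ.approxMatrix p q g m 1 a)‖ ≤ (p : ℝ)⁻¹) ∧
    -- this minor is not identically zero modulo `p`; in particular the domain is nonempty
    (∃ a ∈ PadicKZ.domainO p q g m,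
      ‖PadicKZ.rowMinor q g (PadicKZ.limitMatrix p q g m a)‖ = 1) := by
  exact ⟨PadicKZ.tendstoUniformlyOn_approxMatrix hq hqp hpe hm,
    PadicKZ.analyticOnPolydiscs_limitMatrix hq hqp hpe hm,
    PadicKZ.isAnalyticBundle_distribution hq hqp hpe hm,
    fun _ ha => PadicKZ.norm_rowMinor_limitMatrix_sub_le hq hqp hpe hm ha,
    PadicKZ.exists_norm_rowMinor_limitMatrix_eq_one hq hqp hg hpe hp hm hdeg⟩
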